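/- Let $d,\tilde\zeta>0$ and $\tilde f\in\mathbb R$ with $0<|\tilde f|<\frac{2\sqrt3}{9}\tilde\zeta^{3/2}$, and let $g(z)=|z|^2z-\mathrm i\tilde f$ for $z\in\mathbb C$. Let $H^2_{even}(\mathbb R;\mathbb C)$ be the Sobolev space of even complex-valued $H^2$-functions on $\mathbb R$. The equation $-\tilde\zeta v+v^3=\tilde f$ has exactly three real solutions $v^{(1)}<v^{(2)}<v^{(3)}$. For $(\varepsilon,\kappa)$ in an open neighborhood $J_0$ of $(0,0)$ in $\mathbb R\times\mathbb R$, the algebraic equation $$(\tilde\zeta-\varepsilon\mathrm i)z-(1+\mathrm i\kappa)|z|^2z+\mathrm i\tilde f=0$$ has exactly one solution $z=u^\infty_{\varepsilon,\kappa}$ in some fixed open set $W\ni \mathrm i v^{(2)}$ of $\mathbb C$; it depends continuously on $(\varepsilon,\kappa)\in J_0$, and $u^\infty_{0,0}=\mathrm i v^{(2)}$. There are exactly two twice continuously differentiable, purely imaginary and even solutions $u_i=\tilde u_i+\mathrm i v^{(2)}$, $i=1,2$, with $\tilde u_i\in H^2_{even}(\mathbb R;\mathbb C)$, of $$-du''+\tilde\zeta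 u-|u|^2u+\mathrm i\tilde f=0\quad\text{on }\mathbb R,\qquad u'(0)=0,$$ such that $x\,\mathrm{Im}(u_1'(x))>0$ for all $x\neq0$, respectively $x\,\mathrm{Im}(u_2'(x))<0$ for all $x\ne0$ (one solution for each of the two sign conditions). For $i=1,2$ there exist open neighborhoods $U_i$ of $\tilde u_i$ in $H^2_{even}(\mathbb R;\mathbb C)$ and $J_i\subseteq J_0$ of $(0,0)$ in $\mathbb R\times\mathbb R$ such that for every $(\varepsilon,\kappa)\in J_i$ there is exactly one $\tilde u\in U_i$ satisfying $$-d\tilde u''+\tilde\zeta\tilde u-\varepsilon\mathrm i\tilde u-(1+\mathrm i\kappa)\bigl(g(\tilde u+u^\infty_{\varepsilon,\kappa})-g(u^\infty_{\varepsilon,\kappa})\bigr)=0\quad\text{on }\mathbb R.$$ Equivalently, $u=\tilde u+u^\infty_{\varepsilon,\kappa}$ solves $-du''+(\tilde\zeta-\varepsilon\mathrm i)u-(1+\mathrm i\kappa)|u|^2u+\mathrm i\tilde f=0$ on $\mathbb R$. -/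

import Mathlib

open MeasureTheory
open scoped ContDiff

noncomputable section

namespace LugiatoLefever

/-- The Hilbert space `L²(ℝ; ℂ)`. -/
abbrev L2 : Type := Lp ℂ 2 (volume : Measure ℝ)

/-- `h` is the weak derivative of `u` on `ℝ`. -/
def IsWeakDeriv (u h : L2) : Prop :=
  ∀ φ : ℝ → ℝ, ContDiff ℝ ∞ φ → HasCompactSupport φ →
    ∫ x, deriv φ x • u x = - ∫ x, φ x • h x

lemma integrable_test (u : L2) {φ : ℝ → ℝ} (h : Continuous φ) (hc : HasCompactSupport φ) :
    Integrable (fun x => φ x • u x) :=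
  ((Lp.memLp u).locallyIntegrable (by norm_num)).integrable_smul_left_of_hasCompactSupport h hc

lemma IsWeakDeriv.zero : IsWeakDeriv 0 0 := by
  intro φ _ _
  have h : ∀ ψ : ℝ → ℝ, ∫ x, ψ x • (0 : L2) x = 0 := fun ψ => by
    refine integral_eq_zero_of_ae ?_
    filter_upwards [Lp.coeFn_zero ℂ 2 (volume : Measure ℝ)] with x hx
    rw [hx, Pi.zero_apply, smul_zero]
  rw [h, h, neg_zero]

lemma IsWeakDeriv.add {u h u' h' : L2} (H : IsWeakDeriv u h) (H' : IsWeakDeriv u' h') :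
    IsWeakDeriv (u + u') (h + h') := by
  intro φ hφ hc
  have key : ∀ (a b : L2) (ψ : ℝ → ℝ), Continuous ψ → HasCompactSupport ψ →
      ∫ x, ψ x • (a + b) x = (∫ x, ψ x • a x) + ∫ x, ψ x • b x := by
    intro a b ψ hψ hψc
    rw [← integral_add (integrable_test a hψ hψc) (integrable_test b hψ hψc)]
    refine integral_congr_ae ?_
    filter_upwards [Lp.coeFn_add a b] with x hx
    rw [hx, Pi.add_apply, smul_add]
  rw [key _ _ _ (hφ.continuous_deriv (by simp)) hc.deriv, key _ _ _ hφ.continuous hc,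
    H φ hφ hc, H' φ hφ hc]
  ring

lemma IsWeakDeriv.smul {u h : L2} (c : ℂ) (H : IsWeakDeriv u h) :
    IsWeakDeriv (c • u) (c • h) := by
  intro φ hφ hc
  have key : ∀ (a : L2) (ψ : ℝ → ℝ), ∫ x, ψ x • (c • a) x = c * ∫ x, ψ x • a x := by
    intro a ψ
    rw [← integral_const_mul]
    refine integral_congr_ae ?_
    filter_upwards [Lp.coeFn_smul c a] with x hx
    simp only [hx, Pi.smul_apply, smul_eq_mul, Complex.real_smul]
    ring
  rw [key, key, H φ hφ hc]
  ring

/-- `u` is even: `u (-x) = u x` for almost every `x`. -/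
def IsEven (u : L2) : Prop := ∀ᵐ x : ℝ, u (-x) = u x

lemma ae_neg {p : ℝ → Prop} (h : ∀ᵐ x : ℝ, p x) : ∀ᵐ x : ℝ, p (-x) :=
  (Measure.measurePreserving_neg (volume : Measure ℝ)).quasiMeasurePreserving.ae h

/-- The Sobolev space `H²_even(ℝ; ℂ)` of even functions in `L²` with weak derivatives of first and
second order in `L²`. A function `u` is stored as the triple `(u, u', u'')`, where `u'` and `u''`
are its weak derivatives, and the norm is `(‖u‖² + ‖u'‖² + ‖u''‖²) ^ (1/2)`, the norms on the right
being those of `L²`. -/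
def H2Even : Submodule ℂ (PiLp 2 (fun _ : Fin 3 => L2)) where
  carrier := {w | IsWeakDeriv (w 0) (w 1) ∧ IsWeakDeriv (w 1) (w 2) ∧ IsEven (w 0)}
  zero_mem' := by
    refine ⟨IsWeakDeriv.zero, IsWeakDeriv.zero, ?_⟩
    have h := Lp.coeFn_zero ℂ 2 (volume : Measure ℝ)
    filter_upwards [h, ae_neg h] with x hx hx'
    exact hx'.trans hx.symm
  add_mem' := by
    rintro a b ⟨h1, h2, h3⟩ ⟨k1, k2, k3⟩
    refine ⟨h1.add k1, h2.add k2, ?_⟩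
    have h := Lp.coeFn_add (a 0) (b 0)
    filter_upwards [h, ae_neg h, h3, k3] with x hx hx' e1 e2
    change ((a 0 + b 0 : L2) : ℝ → ℂ) (-x) = ((a 0 + b 0 : L2) : ℝ → ℂ) x
    rw [hx, hx', Pi.add_apply, Pi.add_apply, e1, e2]
  smul_mem' := by
    rintro c a ⟨h1, h2, h3⟩
    refine ⟨h1.smul c, h2.smul c, ?_⟩
    have h := Lp.coeFn_smul c (a 0)
    filter_upwards [h, ae_neg h, h3] with x hx hx' e1
    change ((c • a 0 : L2) : ℝ → ℂ) (-x) = ((c • a 0 : L2) : ℝ → ℂ) x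
    rw [hx, hx', Pi.smul_apply, Pi.smul_apply, e1]

/-- The function `u` underlying an element of `H²_even(ℝ; ℂ)`. -/
def toL2 (w : H2Even) : L2 := (w : PiLp 2 (fun _ : Fin 3 => L2)) 0

/-- The second weak derivative `u''` of an element of `H²_even(ℝ; ℂ)`. -/
def weakDeriv2 (w : H2Even) : L2 := (w : PiLp 2 (fun _ : Fin 3 => L2)) 2

lemma IsWeakDeriv.unique {u h k : L2} (H : IsWeakDeriv u h) (K : IsWeakDeriv u k) : h = k := by
  refine Lp.ext (ae_eq_of_integral_contDiff_smul_eq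
    ((Lp.memLp h).locallyIntegrable (by norm_num)) ((Lp.memLp k).locallyIntegrable (by norm_num))
    fun φ hφ hc => ?_)
  exact neg_injective ((H φ hφ hc).symm.trans (K φ hφ hc))

/-- An element of `H²_even(ℝ; ℂ)` is determined by its underlying function. -/
lemma toL2_injective : Function.Injective toL2 := by
  rintro ⟨a, a1, a2, a3⟩ ⟨b, b1, b2, b3⟩ h
  have h0 : a 0 = b 0 := h
  have h1 : a 1 = b 1 := a1.unique (h0 ▸ b1)
  have h2 : a 2 = b 2 := a2.unique (h1 ▸ b2)
  refine Subtype.ext (PiLp.ext fun i => ?_)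
  fin_cases i
  exacts [h0, h1, h2]

/-- The nonlinearity `g(z) = |z|² z - i f`. -/
def g (f : ℝ) (z : ℂ) : ℂ := (‖z‖ : ℂ) ^ 2 * z - Complex.I * f

/-- The equation `(ζ - ε i) z - (1 + i κ) |z|² z + i f = 0` for a constant state `z`. -/
def IsConstantState (ζ f ε κ : ℝ) (z : ℂ) : Prop :=
  (ζ - ε * Complex.I) * z - (1 + Complex.I * κ) * (‖z‖ : ℂ) ^ 2 * z + Complex.I * f = 0

/-- `u` is the constant `i v` plus a function in `H²_even(ℝ; ℂ)`, is purely imaginary, and solves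
`-d u'' + ζ u - |u|² u + i f = 0` on `ℝ` with `u'(0) = 0`; moreover `σ x Im u'(x) > 0` for all
`x ≠ 0`, where `σ = 1` or `σ = -1`. -/
structure IsHomoclinic (d ζ f v σ : ℝ) (u : ℝ → ℂ) : Prop where
  contDiff : ContDiff ℝ 2 u
  even : ∀ x, u (-x) = u x
  imaginary : ∀ x, (u x).re = 0
  deriv_zero : deriv u 0 = 0
  equation : ∀ x, -(d : ℂ) * deriv (deriv u) x + ζ * u x - (‖u x‖ : ℂ) ^ 2 * u x
    + Complex.I * f = 0
  monotone : ∀ x : ℝ, x ≠ 0 → 0 < σ * (x * (deriv u x).im)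
  tail : ∃ w : H2Even, ∀ᵐ x : ℝ, toL2 w x = u x - Complex.I * v

/-- `w` solves `-d w'' + ζ w - ε i w - (1 + i κ) (g(w + c) - g(c)) = 0` on `ℝ`. -/
def IsSolution (d ζ f ε κ : ℝ) (c : ℂ) (w : H2Even) : Prop :=
  ∀ᵐ x : ℝ, -(d : ℂ) * weakDeriv2 w x + ζ * toL2 w x - ε * Complex.I * toL2 w x
    - (1 + Complex.I * κ) * (g f (toL2 w x + c) - g f c) = 0

end LugiatoLefever

end

/-!
Write `u = i (v + w)` with `v = v₂` and `w` real. The stationary equation becomes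
`d w'' = a w - 3 v w² - w³` with `a = ζ - 3 v² > 0`: the middle root `v` is a saddle point. A solution
with `w, w' ∈ L²` satisfies the first integral `d w'² = w² (a - 2 v w - w² / 2)`, because the constant
of integration is an integrable constant function (`IsPulse.first_integral`). Hence `w(0)` is one of
the two roots of a quadratic polynomial, and uniqueness for the initial value problem leaves at most
one solution for each root. Both exist: `1 / w` solves a linear equation, which gives
`w = 1 / (β - σ α cosh (μ x))` (`exists_isPulse`).

The continuation is the implicit function theorem (`exists_unique_continuation`) for the left-hand
side of the equation as a map from `H²_even` to the even functions in `L²`. It is polynomial in `w` and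
in `(ε, κ, c)` if the constant state `c` is treated as one more parameter, and the continuous function
`c = u^∞_{ε,κ}` is substituted only afterwards. What has to be shown is that the linearization at the
pulse is bijective. On real and imaginary parts it is `-d ∂² + ζ - y²` and `-d ∂² + ζ - 3 y²`, where
`y = v + w`.

* The linearization is `-d ∂² + diag(ζ - v², ζ - 3 v²)`, which is inverted by the Lax-Milgram theorem
  (`exists_rightInverse`), plus multiplication by a function in `L²`. The latter is compact from `H²`
  to `L²`, since evaluation at a point is a bounded functional on `H²`
  (`isCompactOperator_of_Lp`). By the Fredholm alternative it remains to prove injectivity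
  (`bijective_of_injective`).
* In the imaginary part, the Wronskian of a kernel element `q` with `w'` is constant and integrable,
  hence zero; at `x = 0` this forces `q(0) = 0` if `q` is even
  (`IsPulse.eq_zero_of_linearized_im`).
* In the real part, a comparison with `w'` shows that an even kernel element `p ≠ 0` has no zero in
  `(0, ∞)`, whereas `-d y'' + (ζ - y²) y = -f` with `f ≠ 0` implies `∫ p = 0`
  (`IsPulse.eq_zero_of_linearized_re`).

The elements of `H²_even` are related to classical functions by the du Bois-Reymond lemma: a function
in `L²` with a weak derivative in `L²` has a continuous representative, the primitive of its weak
derivative (`IsWeakDeriv.exists_rep`).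
-/

noncomputable section

namespace LugiatoLefever

open Set Filter Topology
open scoped InnerProductSpace

/-! ### Weak derivatives in one dimension -/

lemma intervalIntegrable_of_locallyIntegrable {E : Type*} [NormedAddCommGroup E] {h : ℝ → E}
    (hh : LocallyIntegrable h) (a b : ℝ) : IntervalIntegrable h volume a b :=
  (hh.integrableOn_isCompact isCompact_uIcc).intervalIntegrable

lemma integral_deriv_mul_primitive {h : ℝ → ℝ} (hh : LocallyIntegrable h) {φ : ℝ → ℝ}
    (hφ : ContDiff ℝ ∞ φ) (hc : HasCompactSupport φ) :
    ∫ x, deriv φ x * (∫ t in (0 : ℝ)..x, h t) = - ∫ x, φ x * h x := by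
  have hint : ∀ a b : ℝ, IntervalIntegrable h volume a b := intervalIntegrable_of_locallyIntegrable hh
  obtain ⟨R, hR0, hR⟩ : ∃ R : ℝ, 0 < R ∧ ∀ x, R ≤ |x| → φ x = 0 := by
    simpa using hc.exists_pos_le_norm
  have hR' : ∀ x, R < |x| → deriv φ x = 0 := by
    intro x hx
    have : φ =ᶠ[𝓝 x] fun _ => 0 := by
      filter_upwards [(continuous_abs.tendsto x).eventually (lt_mem_nhds hx)] with y hy
      exact hR y hy.le
    rw [this.deriv_eq, deriv_const]
  have toInterval : ∀ F : ℝ → ℝ, (∀ x, R < |x| → F x = 0) → ∫ x, F x = ∫ x in (-R)..R, F x := by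
    intro F hF
    rw [intervalIntegral.integral_of_le (by linarith), setIntegral_eq_integral_of_ae_compl_eq_zero]
    have : ∀ᵐ x : ℝ, x ≠ -R := by simp [ae_iff, measure_singleton]
    filter_upwards [this] with x hx hx'
    apply hF
    rw [mem_Ioc, not_and_or, not_lt, not_le] at hx'
    rcases hx' with h1 | h1
    · exact lt_abs.2 (Or.inr (by have := lt_of_le_of_ne h1 hx; linarith))
    · exact lt_abs.2 (Or.inl h1)
  rw [toInterval (fun x => deriv φ x * (∫ t in (0 : ℝ)..x, h t)) (fun x hx => by
      simp [hR' x hx]), toInterval (fun x => φ x * h x) (fun x hx => by simp [hR x hx.le])]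
  have hφac : AbsolutelyContinuousOnInterval φ (-R) R :=
    (hφ.of_le (by simp)).contDiffOn.absolutelyContinuousOnInterval
  have h0 : (0 : ℝ) ∈ uIcc (-R) R := by
    rw [uIcc_of_le (by linarith)]; constructor <;> linarith
  have hVac := (hint (-R) R).absolutelyContinuousOnInterval_intervalIntegral h0
  have key := hφac.integral_mul_deriv_eq_deriv_mul hVac
  rw [hR R (le_abs_self R), hR (-R) (by rw [abs_neg]; exact le_abs_self R)] at key
  have hder : ∫ x in (-R)..R, φ x * deriv (fun x => ∫ t in (0 : ℝ)..x, h t) x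
      = ∫ x in (-R)..R, φ x * h x := by
    apply intervalIntegral.integral_congr_ae
    filter_upwards [(hint (-R) R).ae_hasDerivAt_integral] with x hx hx'
    rw [(hx (uIoc_subset_uIcc hx') 0 h0).deriv]
  rw [hder] at key
  linarith

/-- The primitive of a locally integrable function has that function as its weak derivative. -/
lemma integral_deriv_smul_primitive {h : ℝ → ℂ} (hh : LocallyIntegrable h) {φ : ℝ → ℝ}
    (hφ : ContDiff ℝ ∞ φ) (hc : HasCompactSupport φ) :
    ∫ x, deriv φ x • (∫ t in (0 : ℝ)..x, h t) = - ∫ x, φ x • h x := by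
  have hV : Continuous fun x => ∫ t in (0 : ℝ)..x, h t :=
    intervalIntegral.continuous_primitive (intervalIntegrable_of_locallyIntegrable hh) 0
  have hi1 : Integrable fun x => deriv φ x • (∫ t in (0 : ℝ)..x, h t) :=
    hV.locallyIntegrable.integrable_smul_left_of_hasCompactSupport
      (hφ.continuous_deriv (by simp)) hc.deriv
  have hi2 : Integrable fun x => φ x • h x :=
    hh.integrable_smul_left_of_hasCompactSupport hφ.continuous hc
  have part : ∀ L : ℂ →L[ℝ] ℝ, L (∫ x, deriv φ x • (∫ t in (0 : ℝ)..x, h t))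
      = L (- ∫ x, φ x • h x) := by
    intro L
    have hLh : LocallyIntegrable fun x => L (h x) := by
      rw [locallyIntegrable_iff] at hh ⊢
      exact fun k hk => L.integrable_comp (hh k hk)
    rw [map_neg, ← L.integral_comp_comm hi1, ← L.integral_comp_comm hi2]
    simp only [map_smul, smul_eq_mul]
    rw [← integral_deriv_mul_primitive hLh hφ hc]
    refine integral_congr_ae (Eventually.of_forall fun x => ?_)
    simp only
    rw [L.intervalIntegral_comp_comm (intervalIntegrable_of_locallyIntegrable hh _ _)]
  exact Complex.ext (part Complex.reCLM) (part Complex.imCLM)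

/-- The du Bois-Reymond lemma. -/
lemma ae_eq_const_of_integral_deriv_smul_eq_zero {u : ℝ → ℂ} (hu : LocallyIntegrable u)
    (H : ∀ φ : ℝ → ℝ, ContDiff ℝ ∞ φ → HasCompactSupport φ → ∫ x, deriv φ x • u x = 0) :
    ∃ c : ℂ, ∀ᵐ x : ℝ, u x = c := by
  let χ₀ : ContDiffBump (0 : ℝ) := ⟨1, 2, one_pos, one_lt_two⟩
  let χ : ℝ → ℝ := χ₀.normed volume
  have hχ : ContDiff ℝ ∞ χ := χ₀.contDiff_normed
  have hχc : HasCompactSupport χ := χ₀.hasCompactSupport_normed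
  have hχ1 : ∫ x, χ x = 1 := χ₀.integral_normed
  refine ⟨∫ x, χ x • u x, ae_eq_of_integral_contDiff_smul_eq hu
    (continuous_const.locallyIntegrable) fun ψ hψ hψc => ?_⟩
  set m : ℝ := ∫ x, ψ x with hm
  let θ : ℝ → ℝ := fun x => ψ x - m * χ x
  have hθ : ContDiff ℝ ∞ θ := hψ.sub (contDiff_const.mul hχ)
  have hθc : HasCompactSupport θ := hψc.sub hχc.mul_left
  have hiψ : Integrable ψ := hψ.continuous.integrable_of_hasCompactSupport hψc
  have hiχ : Integrable χ := hχ.continuous.integrable_of_hasCompactSupport hχc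
  have hiθ : Integrable θ := hθ.continuous.integrable_of_hasCompactSupport hθc
  have hθ0 : ∫ x, θ x = 0 := by
    simp only [θ]
    rw [integral_sub hiψ (hiχ.const_mul m), integral_const_mul, hχ1]
    simp [hm]
  -- the primitive of `θ` is a test function because `θ` has mean zero
  let φ : ℝ → ℝ := fun x => ∫ t in Iic x, θ t
  obtain ⟨R, hR0, hR⟩ : ∃ R : ℝ, 0 < R ∧ ∀ x, R ≤ |x| → θ x = 0 := by
    simpa using hθc.exists_pos_le_norm
  have hder : ∀ x, HasDerivAt φ (θ x) x := by
    intro x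
    have e : φ = fun y => (∫ t in Iic 0, θ t) + ∫ t in (0 : ℝ)..y, θ t := by
      funext y
      have := intervalIntegral.integral_Iic_sub_Iic (μ := volume) (a := 0) (b := y)
        hiθ.integrableOn hiθ.integrableOn
      simp only [φ]
      rw [← this]; ring
    rw [e]
    exact (intervalIntegral.integral_hasDerivAt_right (hiθ.intervalIntegrable)
      (hθ.continuous.stronglyMeasurableAtFilter _ _) hθ.continuous.continuousAt).const_add _
  have hderiv : deriv φ = θ := funext fun x => (hder x).deriv
  have hφ : ContDiff ℝ ∞ φ := by
    rw [contDiff_infty_iff_deriv, hderiv]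
    exact ⟨fun x => (hder x).differentiableAt, hθ⟩
  have hφc : HasCompactSupport φ := by
    refine HasCompactSupport.intro (isCompact_Icc (a := -R) (b := R)) fun x hx => ?_
    rw [mem_Icc, not_and_or, not_le, not_le] at hx
    rcases hx with h1 | h1
    · refine setIntegral_eq_zero_of_forall_eq_zero fun t ht => hR t ?_
      rw [mem_Iic] at ht
      exact le_abs.2 (Or.inr (by linarith))
    · rw [← hθ0]
      refine setIntegral_eq_integral_of_forall_compl_eq_zero fun t ht => hR t ?_
      rw [mem_Iic, not_le] at ht
      exact le_abs.2 (Or.inl (by linarith))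
  have h1 := H φ hφ hφc
  rw [hderiv] at h1
  have hiψu : Integrable fun x => ψ x • u x :=
    hu.integrable_smul_left_of_hasCompactSupport hψ.continuous hψc
  have hiχu : Integrable fun x => χ x • u x :=
    hu.integrable_smul_left_of_hasCompactSupport hχ.continuous hχc
  simp only [θ, sub_smul, mul_smul] at h1
  have hiχu' : Integrable fun x => m • χ x • u x := hiχu.smul m
  rw [integral_sub hiψu hiχu', integral_smul, sub_eq_zero] at h1
  rw [h1, integral_smul_const]

lemma L2.locallyIntegrable (u : L2) : LocallyIntegrable (u : ℝ → ℂ) :=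
  (Lp.memLp u).locallyIntegrable (by norm_num)

/-- A function in `H¹(ℝ)` has an absolutely continuous representative, the primitive of its weak
derivative. -/
lemma IsWeakDeriv.exists_rep {u h : L2} (H : IsWeakDeriv u h) :
    ∃ U : ℝ → ℂ, (∀ᵐ x : ℝ, u x = U x) ∧ ∀ x y : ℝ, U y - U x = ∫ t in x..y, h t := by
  have hh := L2.locallyIntegrable h
  have hV : Continuous fun x => ∫ t in (0 : ℝ)..x, h t :=
    intervalIntegral.continuous_primitive (intervalIntegrable_of_locallyIntegrable hh) 0
  obtain ⟨c, hc⟩ := ae_eq_const_of_integral_deriv_smul_eq_zero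
    (u := fun x => u x - ∫ t in (0 : ℝ)..x, h t)
    ((L2.locallyIntegrable u).sub hV.locallyIntegrable) (by
      intro φ hφ hφc
      simp only [smul_sub]
      rw [integral_sub, integral_deriv_smul_primitive hh hφ hφc, H φ hφ hφc, sub_self]
      · exact integrable_test u (hφ.continuous_deriv (by simp)) hφc.deriv
      · exact hV.locallyIntegrable.integrable_smul_left_of_hasCompactSupport
          (hφ.continuous_deriv (by simp)) hφc.deriv)
  refine ⟨fun x => c + ∫ t in (0 : ℝ)..x, h t, ?_, fun x y => ?_⟩
  · filter_upwards [hc] with x hx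
    rw [← hx]; ring
  · rw [← intervalIntegral.integral_interval_sub_left (a := 0)
      (intervalIntegrable_of_locallyIntegrable hh _ _) (intervalIntegrable_of_locallyIntegrable hh _ _)]
    ring

lemma integral_norm_unit_le (h : L2) (x : ℝ) : ∫ t in x..(x + 1), ‖h t‖ ≤ ‖h‖ := by
  rw [intervalIntegral.integral_of_le (by linarith)]
  have hm : AEStronglyMeasurable (h : ℝ → ℂ) (volume.restrict (Ioc x (x + 1))) :=
    (Lp.aestronglyMeasurable h).restrict
  rw [integral_norm_eq_lintegral_enorm hm, ← eLpNorm_one_eq_lintegral_enorm, Lp.norm_def]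
  refine ENNReal.toReal_mono (Lp.eLpNorm_ne_top h) ?_
  have := eLpNorm_le_eLpNorm_mul_rpow_measure_univ (p := 1) (q := 2) (by norm_num) hm
  refine this.trans ?_
  simp only [MeasurableSet.univ, Measure.restrict_apply, univ_inter, Real.volume_Ioc]
  rw [show x + 1 - x = 1 by ring]
  simp only [ENNReal.ofReal_one, ENNReal.one_rpow, mul_one]
  exact eLpNorm_restrict_le _ _ _ _

/-- The Sobolev inequality `sup |u| ≤ ‖u‖ + ‖u'‖`. -/
lemma norm_rep_le {u h : L2} {U : ℝ → ℂ} (hU : ∀ᵐ x : ℝ, u x = U x)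
    (hd : ∀ x y : ℝ, U y - U x = ∫ t in x..y, h t) (x : ℝ) : ‖U x‖ ≤ ‖u‖ + ‖h‖ := by
  have hi : ∀ (k : L2) (a b : ℝ), IntervalIntegrable (k : ℝ → ℂ) volume a b :=
    fun k => intervalIntegrable_of_locallyIntegrable (L2.locallyIntegrable k)
  have bound : ∀ᵐ y : ℝ, y ∈ Ioc x (x + 1) → ‖U x‖ ≤ ‖u y‖ + ‖h‖ := by
    filter_upwards [hU] with y hy hy'
    have h1 : ‖∫ t in x..y, h t‖ ≤ ‖h‖ :=
      (intervalIntegral.norm_integral_le_integral_norm hy'.1.le).trans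
        ((intervalIntegral.integral_mono_interval le_rfl hy'.1.le hy'.2
          (Eventually.of_forall fun t => norm_nonneg _) (hi h x (x + 1)).norm).trans
          (integral_norm_unit_le h x))
    calc ‖U x‖ = ‖U y - ∫ t in x..y, h t‖ := by rw [← hd]; simp
      _ ≤ ‖U y‖ + ‖∫ t in x..y, h t‖ := norm_sub_le _ _
      _ ≤ _ := by rw [hy]; gcongr
  calc ‖U x‖ = ∫ _ in x..(x + 1), ‖U x‖ := by simp
    _ ≤ ∫ y in x..(x + 1), (‖u y‖ + ‖h‖) := by
        rw [intervalIntegral.integral_of_le (by linarith),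
          intervalIntegral.integral_of_le (by linarith)]
        refine setIntegral_mono_on_ae ?_ ?_ measurableSet_Ioc bound
        · exact integrableOn_const (by simp)
        · exact ((hi u x (x + 1)).norm.1).add (integrableOn_const (by simp))
    _ = (∫ y in x..(x + 1), ‖u y‖) + ‖h‖ := by
        rw [intervalIntegral.integral_add (hi u _ _).norm (by simp)]
        simp
    _ ≤ _ := by gcongr; exact integral_norm_unit_le u x

/-- A classical derivative is a weak derivative. -/
lemma isWeakDeriv_of_hasDerivAt {u h : L2} {U U' : ℝ → ℂ} (hU : ∀ᵐ x : ℝ, u x = U x)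
    (hU' : ∀ᵐ x : ℝ, h x = U' x) (hd : ∀ x, HasDerivAt U (U' x) x) : IsWeakDeriv u h := by
  intro φ hφ hc
  have e1 : ∫ x, deriv φ x • u x = ∫ x, deriv φ x • U x :=
    integral_congr_ae (by filter_upwards [hU] with x hx; rw [hx])
  have e2 : ∫ x, φ x • h x = ∫ x, φ x • U' x :=
    integral_congr_ae (by filter_upwards [hU'] with x hx; rw [hx])
  have i1 : Integrable fun x => deriv φ x • U x :=
    (integrable_test u (hφ.continuous_deriv (by simp)) hc.deriv).congr
      (by filter_upwards [hU] with x hx; rw [hx])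
  have i2 : Integrable fun x => φ x • U' x :=
    (integrable_test h hφ.continuous hc).congr (by filter_upwards [hU'] with x hx; rw [hx])
  have i3 : Integrable fun x => φ x • U x :=
    (integrable_test u hφ.continuous hc).congr (by filter_upwards [hU] with x hx; rw [hx])
  rw [e1, e2]
  have := integral_bilinear_hasDerivAt_right_eq_neg_left_of_integrable
    (L := ContinuousLinearMap.lsmul ℝ ℝ (E := ℂ)) (u := φ) (v := U) (u' := deriv φ) (v' := U')
    (fun x _ => (hφ.differentiable (by simp) x).hasDerivAt) (fun x _ => hd x)
    (by simpa using i2) (by simpa using i1) (by simpa using i3)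
  simp only [ContinuousLinearMap.lsmul_apply] at this
  rw [this, neg_neg]

/-! ### The classical representatives of a function in `H²` -/

/-- The first weak derivative `u'` of an element of `H²_even(ℝ; ℂ)`. -/
def weakDeriv1 (w : H2Even) : L2 := (w : PiLp 2 (fun _ : Fin 3 => L2)) 1

/-- The continuous representative of an element of `H²_even(ℝ; ℂ)`. -/
def val (w : H2Even) : ℝ → ℂ := w.2.1.exists_rep.choose

/-- The continuous representative of the derivative of an element of `H²_even(ℝ; ℂ)`. -/
def der (w : H2Even) : ℝ → ℂ := w.2.2.1.exists_rep.choose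

lemma toL2_ae_eq (w : H2Even) : ∀ᵐ x : ℝ, toL2 w x = val w x := w.2.1.exists_rep.choose_spec.1

lemma weakDeriv1_ae_eq (w : H2Even) : ∀ᵐ x : ℝ, weakDeriv1 w x = der w x :=
  w.2.2.1.exists_rep.choose_spec.1

lemma val_sub_val (w : H2Even) (x y : ℝ) : val w y - val w x = ∫ t in x..y, weakDeriv1 w t :=
  w.2.1.exists_rep.choose_spec.2 x y

lemma der_sub_der (w : H2Even) (x y : ℝ) : der w y - der w x = ∫ t in x..y, weakDeriv2 w t :=
  w.2.2.1.exists_rep.choose_spec.2 x y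

lemma continuous_der (w : H2Even) : Continuous (der w) := by
  have e : der w = fun y => der w 0 + ∫ t in (0 : ℝ)..y, weakDeriv2 w t := by
    funext y; rw [← der_sub_der]; ring
  rw [e]
  exact continuous_const.add (intervalIntegral.continuous_primitive
    (intervalIntegrable_of_locallyIntegrable (L2.locallyIntegrable _)) 0)

lemma hasDerivAt_of_sub_eq_integral {F k : ℝ → ℂ} {h : ℝ → ℂ} (hk : Continuous k)
    (hh : ∀ᵐ x : ℝ, h x = k x) (H : ∀ x y : ℝ, F y - F x = ∫ t in x..y, h t) (x : ℝ) :
    HasDerivAt F (k x) x := by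
  have e : F = fun y => F 0 + ∫ t in (0 : ℝ)..y, k t := by
    funext y
    rw [← intervalIntegral.integral_congr_ae (f := h) (by filter_upwards [hh] with t ht _ using ht),
      ← H]
    ring
  rw [e]
  exact (intervalIntegral.integral_hasDerivAt_right (hk.intervalIntegrable _ _)
    (hk.stronglyMeasurableAtFilter _ _) hk.continuousAt).const_add _

lemma hasDerivAt_val (w : H2Even) (x : ℝ) : HasDerivAt (val w) (der w x) x :=
  hasDerivAt_of_sub_eq_integral (continuous_der w) (weakDeriv1_ae_eq w) (val_sub_val w) x

lemma hasDerivAt_der {w : H2Even} {k : ℝ → ℂ} (hk : Continuous k)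
    (h : ∀ᵐ x : ℝ, weakDeriv2 w x = k x) (x : ℝ) : HasDerivAt (der w) (k x) x :=
  hasDerivAt_of_sub_eq_integral hk h (der_sub_der w) x

lemma continuous_val (w : H2Even) : Continuous (val w) :=
  continuous_iff_continuousAt.2 fun x => (hasDerivAt_val w x).continuousAt

lemma norm_apply_le (w : H2Even) (i : Fin 3) : ‖(w : PiLp 2 (fun _ : Fin 3 => L2)) i‖ ≤ ‖w‖ :=
  PiLp.norm_apply_le (w : PiLp 2 (fun _ : Fin 3 => L2)) i

lemma norm_val_le (w : H2Even) (x : ℝ) : ‖val w x‖ ≤ 2 * ‖w‖ := by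
  have h := norm_rep_le (toL2_ae_eq w) (val_sub_val w) x
  have h0 : ‖toL2 w‖ ≤ ‖w‖ := norm_apply_le w 0
  have h1 : ‖weakDeriv1 w‖ ≤ ‖w‖ := norm_apply_le w 1
  linarith

lemma norm_der_le (w : H2Even) (x : ℝ) : ‖der w x‖ ≤ 2 * ‖w‖ := by
  have h := norm_rep_le (weakDeriv1_ae_eq w) (der_sub_der w) x
  have h0 : ‖weakDeriv2 w‖ ≤ ‖w‖ := norm_apply_le w 2
  have h1 : ‖weakDeriv1 w‖ ≤ ‖w‖ := norm_apply_le w 1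
  linarith

lemma val_eq_of_ae {w : H2Even} {U : ℝ → ℂ} (hU : Continuous U) (h : ∀ᵐ x : ℝ, toL2 w x = U x) :
    val w = U := by
  refine ((continuous_val w).ae_eq_iff_eq volume hU).1 ?_
  filter_upwards [h, toL2_ae_eq w] with x h1 h2 using h2.symm.trans h1

lemma val_add (v w : H2Even) : val (v + w) = val v + val w := by
  refine val_eq_of_ae ((continuous_val v).add (continuous_val w)) ?_
  filter_upwards [Lp.coeFn_add (toL2 v) (toL2 w), toL2_ae_eq v, toL2_ae_eq w] with x h1 h2 h3
  rw [Pi.add_apply, ← h2, ← h3]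
  exact h1

lemma val_smul (c : ℝ) (w : H2Even) : val (c • w) = c • val w := by
  refine val_eq_of_ae ((continuous_val w).const_smul c) ?_
  filter_upwards [Lp.coeFn_smul c (toL2 w), toL2_ae_eq w] with x h1 h2
  rw [Pi.smul_apply, ← h2]
  exact h1

lemma val_neg_apply (w : H2Even) (x : ℝ) : val w (-x) = val w x := by
  have : val w = fun x => val w (-x) := by
    refine val_eq_of_ae ((continuous_val w).comp continuous_neg) ?_
    filter_upwards [w.2.2.2, ae_neg (toL2_ae_eq w)] with x h1 h2
    rw [← h2]
    exact h1.symm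
  exact (congrFun this x).symm

lemma der_zero (w : H2Even) : der w 0 = 0 := by
  have h1 : HasDerivAt (val w) (der w 0) 0 := hasDerivAt_val w 0
  have h2 : HasDerivAt (fun x => val w (-x)) (-der w 0) 0 := by
    have := (hasDerivAt_val w (-0)).scomp (0 : ℝ) (hasDerivAt_neg (0 : ℝ))
    simpa [Function.comp_def] using this
  simp only [val_neg_apply] at h2
  exact self_eq_neg.1 (h1.unique h2)

lemma eq_zero_of_val_eq_zero {w : H2Even} (h : ∀ x, val w x = 0) : w = 0 := by
  refine toL2_injective (Lp.ext ?_)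
  filter_upwards [toL2_ae_eq w, Lp.coeFn_zero ℂ 2 (volume : Measure ℝ)] with x h1 h2
  rw [h1, h]
  exact h2.symm

lemma memLp_val (w : H2Even) : MemLp (val w) 2 volume :=
  (memLp_congr_ae (toL2_ae_eq w)).1 (Lp.memLp (toL2 w))

lemma memLp_der (w : H2Even) : MemLp (der w) 2 volume :=
  (memLp_congr_ae (weakDeriv1_ae_eq w)).1 (Lp.memLp (weakDeriv1 w))

/-- The evaluation functional `w ↦ w x`. -/
def evalCLM (x : ℝ) : H2Even →L[ℝ] ℂ :=
  LinearMap.mkContinuous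
    { toFun := fun w => val w x
      map_add' := fun v w => by rw [val_add]; rfl
      map_smul' := fun c w => by rw [val_smul]; rfl } 2 fun w => norm_val_le w x

@[simp] lemma evalCLM_apply (x : ℝ) (w : H2Even) : evalCLM x w = val w x := rfl

lemma norm_evalCLM_le (x : ℝ) : ‖evalCLM x‖ ≤ 2 :=
  LinearMap.mkContinuous_norm_le _ (by norm_num) _

/-- Evaluation depends continuously on the point, in operator norm: the functions of the unit ball
of `H²` are Lipschitz with a common constant. -/
lemma continuous_evalCLM : Continuous evalCLM := by
  have hL : LipschitzWith 2 evalCLM := by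
    refine LipschitzWith.of_dist_le_mul fun x y => ?_
    rw [dist_eq_norm, dist_eq_norm]
    refine ContinuousLinearMap.opNorm_le_bound _ (by positivity) fun w => ?_
    have := Convex.norm_image_sub_le_of_norm_hasDerivWithin_le (f := val w) (f' := der w)
      (s := univ) (x := y) (y := x) (C := 2 * ‖w‖) (fun x _ => (hasDerivAt_val w x).hasDerivWithinAt)
      (fun x _ => norm_der_le w x) convex_univ (mem_univ _) (mem_univ _)
    simp only [sub_apply, evalCLM_apply, NNReal.coe_ofNat]
    linarith
  exact hL.continuous

lemma memLp_top_val (w : H2Even) : MemLp (val w) ⊤ volume :=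
  memLp_top_of_bound (continuous_val w).aestronglyMeasurable (2 * ‖w‖)
    (Eventually.of_forall (norm_val_le w))

/-- The embedding of `H²` into `L^∞`. -/
def toLinfty : H2Even →L[ℝ] Lp ℂ ⊤ (volume : Measure ℝ) :=
  LinearMap.mkContinuous
    { toFun := fun w => (memLp_top_val w).toLp (val w)
      map_add' := fun v w => by
        rw [← MemLp.toLp_add]; congr 1; exact val_add v w
      map_smul' := fun c w => by
        rw [RingHom.id_apply, ← MemLp.toLp_const_smul]; congr 1; exact val_smul c w } 2 fun w => by
    refine (Lp.norm_toLp _ (memLp_top_val w)).le.trans ?_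
    refine ENNReal.toReal_le_of_le_ofReal (by positivity) ?_
    rw [eLpNorm_exponent_top]
    exact eLpNormEssSup_le_of_ae_bound (Eventually.of_forall (norm_val_le w))

lemma toLinfty_ae_eq (w : H2Even) : ∀ᵐ x : ℝ, toLinfty w x = val w x :=
  (memLp_top_val w).coeFn_toLp

/-- `w ↦ w` as a bounded real-linear map from `H²` to `L²`. -/
def toL2CLM : H2Even →L[ℝ] L2 :=
  (PiLp.proj (𝕜 := ℝ) 2 (fun _ : Fin 3 => L2) 0).comp (H2Even.restrictScalars ℝ).subtypeL

/-- `w ↦ w''` as a bounded real-linear map from `H²` to `L²`. -/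
def weakDeriv2CLM : H2Even →L[ℝ] L2 :=
  (PiLp.proj (𝕜 := ℝ) 2 (fun _ : Fin 3 => L2) 2).comp (H2Even.restrictScalars ℝ).subtypeL

@[simp] lemma toL2CLM_apply (w : H2Even) : toL2CLM w = toL2 w := rfl
@[simp] lemma weakDeriv2CLM_apply (w : H2Even) : weakDeriv2CLM w = weakDeriv2 w := rfl

/-! ### Completeness and reflections -/

/-- The pairing `u ↦ ∫ φ u` with a test function, as a bounded functional on `L²`. -/
lemma exists_pairing {φ : ℝ → ℝ} (h : Continuous φ) (hc : HasCompactSupport φ) :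
    ∃ T : L2 →L[ℝ] ℂ, ∀ u : L2, T u = ∫ x, φ x • u x := by
  have hm : MemLp φ 2 (volume : Measure ℝ) := h.memLp_of_hasCompactSupport hc
  refine ⟨ContinuousLinearMap.lpPairing volume 2 2 (ContinuousLinearMap.lsmul ℝ ℝ) (hm.toLp φ),
    fun u => ?_⟩
  rw [ContinuousLinearMap.lpPairing_eq_integral]
  refine integral_congr_ae ?_
  filter_upwards [hm.coeFn_toLp] with x hx
  rw [hx, ContinuousLinearMap.lsmul_apply]

lemma isClosed_isWeakDeriv : IsClosed {p : L2 × L2 | IsWeakDeriv p.1 p.2} := by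
  simp only [IsWeakDeriv, ofPred_forall]
  refine isClosed_iInter fun φ => isClosed_iInter fun hφ => isClosed_iInter fun hc => ?_
  obtain ⟨T, hT⟩ := exists_pairing (hφ.continuous_deriv (by simp)) hc.deriv
  obtain ⟨S, hS⟩ := exists_pairing hφ.continuous hc
  simp only [← hT, ← hS]
  exact isClosed_eq (T.continuous.comp continuous_fst) (S.continuous.comp continuous_snd).neg

/-- The reflection `u ↦ u(-·)` of `L²`. -/
def reflect : L2 →L[ℝ] L2 :=
  (Lp.compMeasurePreservingₗᵢ ℝ (fun x : ℝ => -x)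
    (Measure.measurePreserving_neg (volume : Measure ℝ))).toContinuousLinearMap

lemma reflect_ae (u : L2) : ∀ᵐ x : ℝ, reflect u x = u (-x) :=
  Lp.coeFn_compMeasurePreserving u (Measure.measurePreserving_neg (volume : Measure ℝ))

lemma isEven_iff (u : L2) : IsEven u ↔ reflect u = u := by
  constructor
  · intro h
    refine Lp.ext ?_
    filter_upwards [reflect_ae u, h] with x h1 h2 using h1.trans h2
  · intro h
    filter_upwards [reflect_ae u] with x h1
    rw [← h1, h]

lemma reflect_reflect (u : L2) : reflect (reflect u) = u := by
  refine Lp.ext ?_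
  filter_upwards [reflect_ae (reflect u), ae_neg (reflect_ae u)] with x h1 h2
  rw [h1, h2, neg_neg]

lemma isClosed_H2Even : IsClosed (H2Even : Set (PiLp 2 (fun _ : Fin 3 => L2))) := by
  have hp : ∀ i : Fin 3, Continuous fun w : PiLp 2 (fun _ : Fin 3 => L2) => w i :=
    fun i => PiLp.continuous_apply 2 _ i
  have e : (H2Even : Set (PiLp 2 (fun _ : Fin 3 => L2)))
      = {w | IsWeakDeriv (w 0) (w 1)} ∩ ({w | IsWeakDeriv (w 1) (w 2)} ∩ {w | IsEven (w 0)}) := rfl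
  rw [e]
  refine (isClosed_isWeakDeriv.preimage ((hp 0).prodMk (hp 1))).inter
    ((isClosed_isWeakDeriv.preimage ((hp 1).prodMk (hp 2))).inter ?_)
  simp only [isEven_iff]
  exact isClosed_eq (reflect.continuous.comp (hp 0)) (hp 0)

instance : CompleteSpace H2Even := isClosed_H2Even.completeSpace_coe

lemma IsWeakDeriv.reflect {u h : L2} (H : IsWeakDeriv u h) :
    IsWeakDeriv (reflect u) (-reflect h) := by
  intro φ hφ hc
  have e : ∀ (ψ : ℝ → ℝ) (k : L2), ∫ x, ψ x • LugiatoLefever.reflect k x = ∫ x, ψ (-x) • k x := by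
    intro ψ k
    rw [← integral_neg_eq_self (fun x => ψ (-x) • k x)]
    refine integral_congr_ae ?_
    filter_upwards [reflect_ae k] with x hx
    rw [hx, neg_neg]
  have e2 : ∫ x, φ x • (-LugiatoLefever.reflect h : L2) x
      = -∫ x, φ x • LugiatoLefever.reflect h x := by
    rw [← integral_neg]
    refine integral_congr_ae ?_
    filter_upwards [Lp.coeFn_neg (LugiatoLefever.reflect h)] with x hx
    rw [hx, Pi.neg_apply, smul_neg]
  have hc' : HasCompactSupport fun x => φ (-x) := hc.comp_homeomorph (Homeomorph.neg ℝ)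
  have := H (fun x => φ (-x)) (hφ.comp contDiff_neg) hc'
  rw [e2, e, e, neg_neg]
  have hd : ∀ x, deriv (fun x => φ (-x)) x = - deriv φ (-x) := fun x => deriv_comp_neg φ x
  simp only [hd, neg_smul] at this
  rw [integral_neg] at this
  exact neg_injective this

/-- The even functions in `L²`. -/
def L2Even : Submodule ℝ L2 where
  carrier := {u | reflect u = u}
  zero_mem' := map_zero _
  add_mem' := fun {a b} ha hb => by
    change reflect (a + b) = a + b
    rw [map_add, ha, hb]
  smul_mem' := fun c a ha => by
    change reflect (c • a) = c • a
    rw [map_smul, ha]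

lemma mem_L2Even {u : L2} : u ∈ L2Even ↔ reflect u = u := Iff.rfl

instance : CompleteSpace L2Even :=
  (isClosed_eq reflect.continuous continuous_id : IsClosed {u : L2 | reflect u = u}).completeSpace_coe

/-- The projection of `L²` onto the even functions. -/
def evenPart : L2 →L[ℝ] L2Even :=
  ((1 / 2 : ℝ) • (ContinuousLinearMap.id ℝ L2 + reflect)).codRestrict L2Even fun u => by
    rw [mem_L2Even]
    simp only [smul_apply, add_apply,
      ContinuousLinearMap.id_apply, map_smul, map_add, reflect_reflect, add_comm]

lemma coe_evenPart (u : L2) : (evenPart u : L2) = (1 / 2 : ℝ) • (u + reflect u) := rfl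

lemma coe_evenPart_of_mem {u : L2} (h : reflect u = u) : (evenPart u : L2) = u := by
  rw [coe_evenPart, h, ← two_smul ℝ u, smul_smul]
  norm_num

lemma reflect_toL2 (w : H2Even) : reflect (toL2 w) = toL2 w := (isEven_iff _).1 w.2.2.2

lemma reflect_weakDeriv2 (w : H2Even) : reflect (weakDeriv2 w) = weakDeriv2 w := by
  have h1 := w.2.1.reflect
  rw [show (w : PiLp 2 (fun _ : Fin 3 => L2)) 0 = toL2 w from rfl, reflect_toL2] at h1
  have h2 : -reflect (weakDeriv1 w) = weakDeriv1 w := h1.unique w.2.1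
  have h3 := w.2.2.1.reflect.smul (-1)
  simp only [neg_smul, one_smul, neg_neg] at h3
  have h4 : -reflect ((w : PiLp 2 (fun _ : Fin 3 => L2)) 1)
    = (w : PiLp 2 (fun _ : Fin 3 => L2)) 1 := h2
  rw [h4] at h3
  exact h3.unique w.2.2.1

/-! ### The constant-coefficient operator -/

/-- The real-linear map `p + i q ↦ m p + i n q` of `ℂ`. -/
def diagCLM (m n : ℝ) : ℂ →L[ℝ] ℂ :=
  m • Complex.ofRealCLM.comp Complex.reCLM + n • (Complex.I • Complex.ofRealCLM.comp Complex.imCLM)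

lemma diagCLM_apply (m n : ℝ) (z : ℂ) : diagCLM m n z = ⟨m * z.re, n * z.im⟩ := by
  apply Complex.ext <;> simp [diagCLM]

/-- A real-linear map of `ℂ` acting pointwise on `L²`. -/
abbrev pointwise (M : ℂ →L[ℝ] ℂ) : L2 →L[ℝ] L2 := M.compLpL 2 volume

lemma pointwise_ae (M : ℂ →L[ℝ] ℂ) (u : L2) : ∀ᵐ x : ℝ, pointwise M u x = M (u x) :=
  M.coeFn_compLpL u

lemma reflect_pointwise (M : ℂ →L[ℝ] ℂ) (u : L2) :
    reflect (pointwise M u) = pointwise M (reflect u) := by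
  refine Lp.ext ?_
  filter_upwards [reflect_ae (pointwise M u), pointwise_ae M (reflect u), reflect_ae u,
    ae_neg (pointwise_ae M u)] with x h1 h2 h3 h4
  rw [h1, h2, h3, h4]

/-- The Sobolev space `H¹(ℝ; ℂ)` as a real Hilbert space of pairs `(u, u')`. -/
def H1 : Submodule ℝ (WithLp 2 (L2 × L2)) where
  carrier := {p | IsWeakDeriv p.fst p.snd}
  zero_mem' := IsWeakDeriv.zero
  add_mem' := fun ha hb => IsWeakDeriv.add ha hb
  smul_mem' := fun c _ ha => IsWeakDeriv.smul (c : ℂ) ha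

instance : CompleteSpace H1 := by
  have : IsClosed (H1 : Set (WithLp 2 (L2 × L2))) :=
    isClosed_isWeakDeriv.preimage
      ((WithLp.fstL 2 ℝ L2 L2).continuous.prodMk (WithLp.sndL 2 ℝ L2 L2).continuous)
  exact this.completeSpace_coe

/-- The function `u` underlying `(u, u') ∈ H¹`. -/
def H1.fst : H1 →L[ℝ] L2 := (WithLp.fstL 2 ℝ L2 L2).comp H1.subtypeL

/-- The weak derivative `u'` of `(u, u') ∈ H¹`. -/
def H1.snd : H1 →L[ℝ] L2 := (WithLp.sndL 2 ℝ L2 L2).comp H1.subtypeL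

lemma H1.isWeakDeriv (z : H1) : IsWeakDeriv (H1.fst z) (H1.snd z) := z.2

lemma H1.exists_of_isWeakDeriv {u h : L2} (H : IsWeakDeriv u h) :
    ∃ z : H1, H1.fst z = u ∧ H1.snd z = h := ⟨⟨WithLp.toLp 2 (u, h), H⟩, rfl, rfl⟩

lemma H1.norm_sq (z : H1) : ‖z‖ ^ 2 = ‖H1.fst z‖ ^ 2 + ‖H1.snd z‖ ^ 2 :=
  WithLp.prod_norm_sq_eq_of_L2 (z : WithLp 2 (L2 × L2))

lemma mul_norm_sq_le_inner_diag {m n c : ℝ} (hm : c ≤ m) (hn : c ≤ n) (u : L2) :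
    c * ‖u‖ ^ 2 ≤ ⟪pointwise (diagCLM m n) u, u⟫_ℝ := by
  rw [← real_inner_self_eq_norm_sq, L2.inner_def, L2.inner_def, ← integral_const_mul]
  refine integral_mono_ae ((L2.integrable_inner u u).const_mul c)
    (L2.integrable_inner _ u) ?_
  filter_upwards [pointwise_ae (diagCLM m n) u] with x hx
  rw [hx, diagCLM_apply]
  simp only [Complex.inner, Complex.mul_re, Complex.conj_re, Complex.conj_im]
  nlinarith [mul_le_mul_of_nonneg_right hm (sq_nonneg (u x).re),
    mul_le_mul_of_nonneg_right hn (sq_nonneg (u x).im)]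

/-- The bounded bilinear form of the operator `-d ∂² + M` on `H¹`. -/
def energyForm (d : ℝ) (M : ℂ →L[ℝ] ℂ) : H1 →L[ℝ] H1 →L[ℝ] ℝ :=
  d • (innerSL ℝ).bilinearComp H1.snd H1.snd +
    (innerSL ℝ).bilinearComp ((pointwise M).comp H1.fst) H1.fst

lemma energyForm_apply (d : ℝ) (M : ℂ →L[ℝ] ℂ) (z v : H1) : energyForm d M z v =
    d * ⟪H1.snd z, H1.snd v⟫_ℝ + ⟪pointwise M (H1.fst z), H1.fst v⟫_ℝ := rfl

lemma isCoercive_energyForm {d m n : ℝ} (hd : 0 < d) (hm : 0 < m) (hn : 0 < n) :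
    IsCoercive (energyForm d (diagCLM m n)) := by
  refine ⟨min d (min m n), by positivity, fun z => ?_⟩
  rw [energyForm_apply, mul_assoc, ← sq, H1.norm_sq, real_inner_self_eq_norm_sq, mul_add, add_comm]
  refine add_le_add ?_ (mul_norm_sq_le_inner_diag ?_ ?_ _)
  · gcongr; exact min_le_left _ _
  · exact (min_le_right _ _).trans (min_le_left _ _)
  · exact (min_le_right _ _).trans (min_le_right _ _)

lemma inner_smul_test (k : L2) {φ : ℝ → ℝ} (h : Continuous φ) (hc : HasCompactSupport φ) (c : ℂ)
    {t : L2} (ht : ∀ᵐ x : ℝ, t x = φ x * c) :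
    ⟪k, t⟫_ℝ = (starRingEnd ℂ c * ∫ x, φ x • k x).re := by
  rw [L2.inner_def, ← integral_const_mul, ← Complex.reCLM_apply,
    ← ContinuousLinearMap.integral_comp_comm _ ((integrable_test k h hc).const_mul _)]
  refine integral_congr_ae ?_
  filter_upwards [ht] with x hx
  rw [hx]
  simp only [Complex.inner, Complex.mul_re, Complex.conj_re, Complex.conj_im, Complex.ofReal_re,
    Complex.ofReal_im, Complex.reCLM_apply, Complex.real_smul, Complex.mul_im]
  ring

lemma exists_L2_test {ψ : ℝ → ℝ} (h : Continuous ψ) (hc : HasCompactSupport ψ) (c : ℂ) :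
    ∃ t : L2, ∀ᵐ x : ℝ, t x = ψ x * c := by
  have hm : MemLp (fun x => (ψ x : ℂ) * c) 2 (volume : Measure ℝ) := by
    refine Continuous.memLp_of_hasCompactSupport
      ((Complex.continuous_ofReal.comp h).mul continuous_const) ?_
    exact HasCompactSupport.mul_right (f := fun x => (ψ x : ℂ)) (hc.comp_left Complex.ofReal_zero)
  exact ⟨hm.toLp _, hm.coeFn_toLp⟩

/-- A weak solution in `H¹` of `-d u'' + M u = k` has the second weak derivative `(M u - k) / d`. -/
lemma isWeakDeriv_of_energyForm {d : ℝ} (hd : 0 < d) {M : ℂ →L[ℝ] ℂ} {k : L2} {z : H1}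
    (H : ∀ v : H1, energyForm d M z v = ⟪k, H1.fst v⟫_ℝ) :
    IsWeakDeriv (H1.snd z) (d⁻¹ • (pointwise M (H1.fst z) - k)) := by
  intro φ hφ hc
  have hφ' : Continuous (deriv φ) := hφ.continuous_deriv (by simp)
  have key : ∀ c : ℂ, (starRingEnd ℂ c * ∫ x, deriv φ x • H1.snd z x).re
      = (starRingEnd ℂ c * - ∫ x, φ x • (d⁻¹ • (pointwise M (H1.fst z) - k) : L2) x).re := by
    intro c
    obtain ⟨t0, ht0⟩ := exists_L2_test hφ.continuous hc c
    obtain ⟨t1, ht1⟩ := exists_L2_test hφ' hc.deriv c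
    have hw : IsWeakDeriv t0 t1 :=
      isWeakDeriv_of_hasDerivAt (U := fun x => (φ x : ℂ) * c) (U' := fun x => ((deriv φ x : ℝ) : ℂ) * c)
        ht0 ht1 fun x => ((hφ.differentiable (by simp) x).hasDerivAt.ofReal_comp).mul_const c
    obtain ⟨v, hv0, hv1⟩ := H1.exists_of_isWeakDeriv hw
    have h1 := H v
    rw [energyForm_apply, hv0, hv1] at h1
    have h2 : ⟪d⁻¹ • (pointwise M (H1.fst z) - k), t0⟫_ℝ
        = - ⟪H1.snd z, t1⟫_ℝ := by
      rw [real_inner_smul_left, inner_sub_left]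
      field_simp
      linarith
    rw [← inner_smul_test _ hφ' hc.deriv c ht1, mul_neg, Complex.neg_re,
      ← inner_smul_test _ hφ.continuous hc c ht0, h2, neg_neg]
  refine Complex.ext (by simpa using key 1) ?_
  have := key Complex.I
  simpa using this

/-- The constant-coefficient operator `-d ∂² + diag(m, n)` on `H²_even` has a bounded right
inverse, precomposed with the projection onto the even functions. -/
lemma exists_rightInverse {d m n : ℝ} (hd : 0 < d) (hm : 0 < m) (hn : 0 < n) :
    ∃ G : L2 →L[ℝ] H2Even, ∀ k : L2, reflect k = k →
      -d • weakDeriv2 (G k) + pointwise (diagCLM m n) (toL2 (G k)) = k := by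
  set M := diagCLM m n with hM
  let e := (isCoercive_energyForm hd hm hn).continuousLinearEquivOfBilin
  let S : L2 →L[ℝ] H1 := (e.symm : H1 →L[ℝ] H1).comp (ContinuousLinearMap.adjoint H1.fst)
  have hS : ∀ (k : L2) (v : H1), energyForm d M (S k) v = ⟪k, H1.fst v⟫_ℝ := by
    intro k v
    rw [← (isCoercive_energyForm hd hm hn).continuousLinearEquivOfBilin_apply (S k) v,
      ← ContinuousLinearMap.adjoint_inner_left]
    congr 1
    exact e.apply_symm_apply _
  let T : L2 →L[ℝ] L2 := d⁻¹ • ((pointwise M).comp (H1.fst.comp S) - ContinuousLinearMap.id ℝ L2)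
  have hT : ∀ k, T k = d⁻¹ • (pointwise M (H1.fst (S k)) - k) := fun k => rfl
  have hST : ∀ k, IsWeakDeriv (H1.snd (S k)) (T k) := fun k =>
    isWeakDeriv_of_energyForm hd (hS k)
  let c : ℂ := ((1 / 2 : ℝ) : ℂ)
  let comps : Fin 3 → (L2 →L[ℝ] L2) := ![
    (1 / 2 : ℝ) • (H1.fst.comp S + reflect.comp (H1.fst.comp S)),
    (1 / 2 : ℝ) • (H1.snd.comp S + -reflect.comp (H1.snd.comp S)),
    (1 / 2 : ℝ) • (T + reflect.comp T)]
  let G0 : L2 →L[ℝ] PiLp 2 (fun _ : Fin 3 => L2) :=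
    ((PiLp.continuousLinearEquiv 2 ℝ (fun _ : Fin 3 => L2)).symm :
      (Fin 3 → L2) →L[ℝ] PiLp 2 (fun _ : Fin 3 => L2)).comp (ContinuousLinearMap.pi comps)
  have hG0 : ∀ k, G0 k ∈ H2Even.restrictScalars ℝ := by
    intro k
    refine ⟨?_, ?_, ?_⟩
    · exact ((H1.isWeakDeriv (S k)).add (H1.isWeakDeriv (S k)).reflect).smul c
    · have h2 := (hST k).reflect.smul (-1)
      simp only [neg_smul, one_smul, neg_neg] at h2
      exact ((hST k).add h2).smul c
    · rw [isEven_iff]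
      change reflect ((1 / 2 : ℝ) • (H1.fst (S k) + reflect (H1.fst (S k))))
        = (1 / 2 : ℝ) • (H1.fst (S k) + reflect (H1.fst (S k)))
      rw [map_smul, map_add, reflect_reflect, add_comm]
  refine ⟨G0.codRestrict (H2Even.restrictScalars ℝ) hG0, fun k hk => ?_⟩
  change -d • ((1 / 2 : ℝ) • (T k + reflect (T k)))
    + pointwise M ((1 / 2 : ℝ) • (H1.fst (S k) + reflect (H1.fst (S k)))) = k
  rw [hT, map_smul, map_smul, map_sub, map_add, hk, reflect_pointwise]
  have hd0 : d ≠ 0 := hd.ne'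
  match_scalars <;> field_simp <;> norm_num

/-! ### Relatively compact perturbations -/

/-- An `L²` family `K` of bounded functionals defines a compact operator `w ↦ K(·) w` into `L²`:
it is a limit of operators of finite rank, given by simple functions `K`. -/
lemma isCompactOperator_of_Lp {H : Type*} [NormedAddCommGroup H] [NormedSpace ℝ H]
    (K : Lp (H →L[ℝ] ℂ) 2 (volume : Measure ℝ)) :
    IsCompactOperator ((((ContinuousLinearMap.apply ℝ ℂ (E := H)).compLpL₂ 2
      (volume : Measure ℝ)).flip K : H →L[ℝ] L2)) := by
  set B := (ContinuousLinearMap.apply ℝ ℂ (E := H)).compLpL₂ 2 (volume : Measure ℝ) with hB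
  have hBa : ∀ (w : H) (K : Lp (H →L[ℝ] ℂ) 2 (volume : Measure ℝ)),
      ∀ᵐ x : ℝ, B w K x = K x w := fun w K =>
    ContinuousLinearMap.coeFn_compLpL (ContinuousLinearMap.apply ℝ ℂ w) K
  refine Lp.induction (by norm_num) (motive := fun K => IsCompactOperator (B.flip K : H →L[ℝ] L2))
    ?_ ?_ ?_ K
  · intro c s hs hμs
    rw [Lp.simpleFunc.coe_indicatorConst]
    have hfac : ∃ J : ℂ →L[ℝ] L2, ∀ z, J z = indicatorConstLp 2 hs hμs.ne z := by
      refine ⟨LinearMap.toContinuousLinearMap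
        { toFun := fun z => indicatorConstLp 2 hs hμs.ne z
          map_add' := fun z z' => by
            refine Lp.ext ?_
            filter_upwards [indicatorConstLp_coeFn (p := 2) (hs := hs) (hμs := hμs.ne) (c := z + z'),
              indicatorConstLp_coeFn (p := 2) (hs := hs) (hμs := hμs.ne) (c := z),
              indicatorConstLp_coeFn (p := 2) (hs := hs) (hμs := hμs.ne) (c := z'),
              Lp.coeFn_add (indicatorConstLp 2 hs hμs.ne z) (indicatorConstLp 2 hs hμs.ne z')]
              with x h1 h2 h3 h4
            rw [h1, h4, Pi.add_apply, h2, h3]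
            by_cases hx : x ∈ s <;> simp [hx]
          map_smul' := fun r z => by
            refine Lp.ext ?_
            filter_upwards [indicatorConstLp_coeFn (p := 2) (hs := hs) (hμs := hμs.ne) (c := r • z),
              indicatorConstLp_coeFn (p := 2) (hs := hs) (hμs := hμs.ne) (c := z),
              Lp.coeFn_smul r (indicatorConstLp 2 hs hμs.ne z)] with x h1 h2 h3
            rw [RingHom.id_apply, h1, h3, Pi.smul_apply, h2]
            by_cases hx : x ∈ s <;> simp [hx] }, fun z => rfl⟩
    obtain ⟨J, hJ⟩ := hfac
    have e : B.flip (indicatorConstLp 2 hs hμs.ne c) = J.comp c := by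
      ext1 w
      refine Lp.ext ?_
      rw [ContinuousLinearMap.comp_apply, hJ, ContinuousLinearMap.flip_apply]
      filter_upwards [hBa w (indicatorConstLp 2 hs hμs.ne c),
        indicatorConstLp_coeFn (p := 2) (hs := hs) (hμs := hμs.ne) (c := c),
        indicatorConstLp_coeFn (p := 2) (hs := hs) (hμs := hμs.ne) (c := c w)] with x h1 h2 h3
      rw [h1, h2, h3]
      by_cases hx : x ∈ s <;> simp [hx]
    rw [e]
    exact (isCompactOperator_of_locallyCompactSpace_rng J).comp_clm c
  · intro f g hf hg _ h1 h2
    rw [map_add]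
    exact h1.add h2
  · exact isClosed_setOfPred_isCompactOperator.preimage B.flip.continuous

lemma exists_compact_of_continuous {H : Type*} [NormedAddCommGroup H] [NormedSpace ℝ H]
    {δ : ℝ → H →L[ℝ] ℂ} (hδ : Continuous δ) {C : ℝ} (hC : ∀ x, ‖δ x‖ ≤ C) {q : ℝ → ℝ}
    (hq : MemLp q 2 (volume : Measure ℝ)) :
    ∃ V : H →L[ℝ] L2, IsCompactOperator V ∧ ∀ w, ∀ᵐ x : ℝ, V w x = q x * δ x w := by
  have hK : MemLp (fun x => q x • δ x) 2 (volume : Measure ℝ) := by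
    refine (hq.const_mul C).mono (hq.aestronglyMeasurable.smul hδ.aestronglyMeasurable)
      (Eventually.of_forall fun x => ?_)
    rw [norm_smul, norm_mul, mul_comm]
    gcongr
    exact (hC x).trans (le_abs_self C)
  refine ⟨_, isCompactOperator_of_Lp (hK.toLp _), fun w => ?_⟩
  filter_upwards [ContinuousLinearMap.coeFn_compLpL (ContinuousLinearMap.apply ℝ ℂ w) (hK.toLp _),
    hK.coeFn_toLp] with x h1 h2
  refine h1.trans ?_
  rw [h2]
  simp

/-- Multiplication by an `L²` function is a compact operator from `H²` to `L²`. -/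
lemma exists_compact_mul {q : ℝ → ℝ} (hq : MemLp q 2 (volume : Measure ℝ)) :
    ∃ V : H2Even →L[ℝ] L2, IsCompactOperator V ∧ ∀ w, ∀ᵐ x : ℝ, V w x = q x * val w x :=
  exists_compact_of_continuous continuous_evalCLM norm_evalCLM_le hq

/-- The Fredholm alternative for `-d ∂² + diag(m, n) + V` on even functions, with `V` relatively
compact: an injective operator is bijective. -/
lemma bijective_of_injective {d m n : ℝ} (hd : 0 < d) (hm : 0 < m) (hn : 0 < n)
    {V : H2Even →L[ℝ] L2} (hV : IsCompactOperator V) (hVe : ∀ w, reflect (V w) = V w)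
    {L : H2Even →L[ℝ] L2Even}
    (hL : ∀ w, (L w : L2) = -d • weakDeriv2 w + pointwise (diagCLM m n) (toL2 w) + V w)
    (hinj : ∀ w, L w = 0 → w = 0) : Function.Bijective L := by
  obtain ⟨G, hG⟩ := exists_rightInverse hd hm hn
  let T : L2Even →L[ℝ] L2Even := -evenPart.comp (V.comp (G.comp L2Even.subtypeL))
  have hT : IsCompactOperator T := by
    have h1 : IsCompactOperator (V.comp (G.comp L2Even.subtypeL)) :=
      hV.comp_clm (G.comp L2Even.subtypeL)
    exact (h1.clm_comp evenPart).neg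
  have hTk : ∀ k : L2Even, (T k : L2) = -V (G k) := fun k => by
    change ((-evenPart (V (G k)) : L2Even) : L2) = _
    rw [Submodule.coe_neg, coe_evenPart_of_mem (hVe _)]
  have hLG : ∀ k : L2Even, L (G k) = k - T k := by
    intro k
    refine Subtype.ext ?_
    rw [hL, hG k k.2, Submodule.coe_sub, hTk, sub_neg_eq_add]
  refine ⟨(injective_iff_map_eq_zero L).2 hinj, ?_⟩
  rcases hT.hasEigenvalue_or_mem_resolventSet (one_ne_zero (α := ℝ)) with h | h
  · exfalso
    obtain ⟨k, hk⟩ := h.exists_hasEigenvector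
    have hk1 : T k = k := by simpa using hk.apply_eq_smul
    have h0 : G k = 0 := hinj _ (by rw [hLG, hk1, sub_self])
    have h1 := hTk k
    rw [h0, map_zero, neg_zero, hk1] at h1
    exact hk.2 (Subtype.ext h1)
  · have hu : IsUnit ((1 : L2Even →L[ℝ] L2Even) - T) := by
      simpa [spectrum.mem_resolventSet_iff] using h
    obtain ⟨e, he⟩ := hu
    intro k
    refine ⟨G ((e⁻¹ : (L2Even →L[ℝ] L2Even)ˣ).val k : L2Even), ?_⟩
    rw [hLG]
    have h2 : (e : L2Even →L[ℝ] L2Even) * (e⁻¹ : (L2Even →L[ℝ] L2Even)ˣ).val = 1 := e.mul_inv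
    have h3 := congrArg (fun S : L2Even →L[ℝ] L2Even => S k) h2
    rw [he] at h3
    exact h3

/-! ### The homoclinic profile -/

/-- Uniqueness for the linear equation `e'' = Q e`. -/
lemma eq_zero_of_linear_ode {Q e e' : ℝ → ℝ} (hQ : Continuous Q)
    (he : ∀ x, HasDerivAt e (e' x) x) (he' : ∀ x, HasDerivAt e' (Q x * e x) x) {x₀ : ℝ}
    (h0 : e x₀ = 0) (h1 : e' x₀ = 0) (x : ℝ) : e x = 0 := by
  set R : ℝ := |x - x₀| + 1 with hR
  have hRx : |x - x₀| < R := by rw [hR]; linarith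
  have hR0 : 0 < R := by positivity
  obtain ⟨K, hK⟩ := (isCompact_Icc (a := x₀ - R) (b := x₀ + R)).exists_bound_of_continuousOn
    hQ.continuousOn
  have hLip : ∀ t ∈ Ioo (x₀ - R) (x₀ + R),
      LipschitzOnWith (max 1 K.toNNReal) (fun p : ℝ × ℝ => (p.2, Q t * p.1)) univ := by
    intro t ht
    have hQt : |Q t| ≤ ((max 1 K.toNNReal : NNReal) : ℝ) := by
      rw [NNReal.coe_max]
      exact (hK t (Ioo_subset_Icc_self ht)).trans ((Real.le_coe_toNNReal K).trans (le_max_right _ _))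
    have h1K : (1 : ℝ) ≤ ((max 1 K.toNNReal : NNReal) : ℝ) := by
      rw [NNReal.coe_max]; exact le_max_left _ _
    refine LipschitzOnWith.of_dist_le_mul fun p _ p' _ => ?_
    simp only [Prod.dist_eq, Real.dist_eq, ← mul_sub, abs_mul]
    refine max_le ?_ ?_
    · calc |p.2 - p'.2| ≤ 1 * max |p.1 - p'.1| |p.2 - p'.2| := by
            rw [one_mul]; exact le_max_right _ _
        _ ≤ _ := by gcongr
    · gcongr
      exact le_max_left _ _
  have hx₀ : x₀ ∈ Ioo (x₀ - R) (x₀ + R) := ⟨by linarith, by linarith⟩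
  have hx : x ∈ Ioo (x₀ - R) (x₀ + R) := by
    rw [abs_lt] at hRx; exact ⟨by linarith [hRx.1], by linarith [hRx.2]⟩
  have := ODE_solution_unique_of_mem_Ioo (f := fun t => (e t, e' t)) (g := fun _ => ((0 : ℝ), (0 : ℝ)))
    hLip hx₀ (fun t _ => ⟨(he t).prodMk (he' t), mem_univ _⟩)
    (fun t _ => ⟨(hasDerivAt_const t ((0 : ℝ), (0 : ℝ))).congr_deriv (by simp [Prod.zero_eq_mk]), mem_univ _⟩)
    (by simp [h0, h1]) hx
  exact congrArg Prod.fst this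

/-- `w = w(x)`, with derivative `w'`, is a homoclinic solution of
`d w'' = (ζ - 3 v²) w - 3 v w² - w³`, the equation of `-d y'' + ζ y - y³ + f = 0` for
`w = y - v`, where `v` is a constant solution. The sign `σ` is that of `x w'(x)`. -/
structure IsPulse (d ζ v σ : ℝ) (w w' : ℝ → ℝ) : Prop where
  hasDerivAt : ∀ x, HasDerivAt w (w' x) x
  hasDerivAt' : ∀ x, HasDerivAt w' (((ζ - 3 * v ^ 2) * w x - 3 * v * w x ^ 2 - w x ^ 3) / d) x
  deriv_zero : w' 0 = 0
  monotone : ∀ x, x ≠ 0 → 0 < σ * (x * w' x)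
  memLp : MemLp w 2 (volume : Measure ℝ)
  memLp' : MemLp w' 2 (volume : Measure ℝ)
  bounded : ∃ C, ∀ x, |w x| ≤ C

lemma memLp_two_inv_cosh {μ : ℝ} (hμ : 0 < μ) :
    MemLp (fun x => (Real.cosh (μ * x))⁻¹) 2 (volume : Measure ℝ) := by
  have hc : Continuous fun x => (Real.cosh (μ * x))⁻¹ :=
    (Real.continuous_cosh.comp (continuous_const.mul continuous_id)).inv₀
      fun x => (Real.cosh_pos _).ne'
  rw [memLp_two_iff_integrable_sq hc.aestronglyMeasurable]
  refine ((integrable_inv_one_add_sq).comp_mul_left' hμ.ne').mono (hc.pow 2).aestronglyMeasurable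
    (Eventually.of_forall fun x => ?_)
  rw [Real.norm_of_nonneg (by positivity), Real.norm_of_nonneg (by positivity), inv_pow]
  gcongr
  rw [Real.cosh_sq']
  gcongr 1 + ?_
  refine sq_le_sq.2 ?_
  rw [Real.abs_sinh]
  exact Real.self_le_sinh_iff.2 (abs_nonneg _)

/-- The pulse is explicit: `1 / w` solves a linear equation, so that
`w = 1 / (β - σ α cosh (μ x))`. -/
lemma exists_isPulse {d ζ v σ : ℝ} (hd : 0 < d) (ha : 0 < ζ - 3 * v ^ 2) (hσ : σ = 1 ∨ σ = -1) :
    ∃ w w' : ℝ → ℝ, IsPulse d ζ v σ w w' ∧ (∀ x, w (-x) = w x) ∧ σ * w 0 < 0 ∧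
      ζ - 3 * v ^ 2 - 2 * v * w 0 - w 0 ^ 2 / 2 = 0 := by
  set a := ζ - 3 * v ^ 2 with ha_def
  clear_value a
  obtain ⟨β, hβ⟩ : ∃ β : ℝ, v = a * β := ⟨v / a, by field_simp⟩
  obtain ⟨α, hα0, hα⟩ : ∃ α : ℝ, 0 < α ∧ α ^ 2 = β ^ 2 + 1 / (2 * a) :=
    ⟨√(β ^ 2 + 1 / (2 * a)), by positivity, Real.sq_sqrt (by positivity)⟩
  obtain ⟨μ, hμ0, hμ⟩ : ∃ μ : ℝ, 0 < μ ∧ a = d * μ ^ 2 :=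
    ⟨√(a / d), by positivity, by rw [Real.sq_sqrt (by positivity)]; field_simp⟩
  have hσ2 : σ ^ 2 = 1 := by rcases hσ with h | h <;> rw [h] <;> norm_num
  have hσa : |σ| = 1 := by rcases hσ with h | h <;> rw [h] <;> norm_num
  have ha2 : 0 < 1 / (2 * a) := by positivity
  have hαβ : |β| < α := abs_lt_of_sq_lt_sq (by rw [hα]; linarith) hα0.le
  set s : ℝ → ℝ := fun x => β - σ * α * Real.cosh (μ * x) with hs
  set s' : ℝ → ℝ := fun x => -(σ * α * μ * Real.sinh (μ * x)) with hs'
  have hds : ∀ x, HasDerivAt s (s' x) x := by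
    intro x
    have h := ((((hasDerivAt_id x).const_mul μ).cosh).const_mul (σ * α)).const_sub β
    refine h.congr_deriv ?_
    simp only [hs', id]; ring
  have hds' : ∀ x, HasDerivAt s' (μ ^ 2 * (s x - β)) x := by
    intro x
    have h := ((((hasDerivAt_id x).const_mul μ).sinh).const_mul (σ * α * μ)).neg
    refine h.congr_deriv ?_
    simp only [hs, id]; ring
  have hsq : ∀ x, s' x ^ 2 = μ ^ 2 * (s x ^ 2 - 2 * β * s x - 1 / (2 * a)) := by
    intro x
    have e1 : s' x ^ 2 = σ ^ 2 * α ^ 2 * μ ^ 2 * Real.sinh (μ * x) ^ 2 := by simp only [hs']; ring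
    have e2 : s x ^ 2 - 2 * β * s x = σ ^ 2 * α ^ 2 * Real.cosh (μ * x) ^ 2 - β ^ 2 := by
      simp only [hs]; ring
    rw [e1, e2, hσ2, Real.cosh_sq]
    linear_combination -μ ^ 2 * hα
  have hlow : ∀ x, (α - |β|) * Real.cosh (μ * x) ≤ |s x| := by
    intro x
    have h1 : |σ * α * Real.cosh (μ * x)| - |β| ≤ |s x| := by
      rw [hs]; simp only; rw [abs_sub_comm]; exact abs_sub_abs_le_abs_sub _ _
    rw [abs_mul, abs_mul, hσa, abs_of_pos hα0, abs_of_pos (Real.cosh_pos _), one_mul] at h1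
    have h2 : |β| * 1 ≤ |β| * Real.cosh (μ * x) := by gcongr; exact Real.one_le_cosh _
    linarith
  have hpos : ∀ x, 0 < |s x| := fun x =>
    lt_of_lt_of_le (mul_pos (by linarith) (Real.cosh_pos _)) (hlow x)
  have hne : ∀ x, s x ≠ 0 := fun x => abs_pos.1 (hpos x)
  have hc0 : 0 < α - |β| := by linarith
  have hbw : ∀ x, |(s x)⁻¹| ≤ (α - |β|)⁻¹ * (Real.cosh (μ * x))⁻¹ := by
    intro x
    rw [abs_inv, ← mul_inv]
    exact inv_anti₀ (mul_pos hc0 (Real.cosh_pos _)) (hlow x)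
  have hcs : Continuous s := continuous_iff_continuousAt.2 fun x => (hds x).continuousAt
  have hcs' : Continuous s' := continuous_iff_continuousAt.2 fun x => (hds' x).continuousAt
  have hci : Continuous fun x => (s x)⁻¹ := hcs.inv₀ hne
  have hmono : ∀ x, x ≠ 0 → 0 < σ * (x * (-s' x / s x ^ 2)) := by
    intro x hx
    have e : σ * (x * (-s' x / s x ^ 2)) = (σ ^ 2 * α * (μ * x * Real.sinh (μ * x))) / s x ^ 2 := by
      simp only [hs']; ring
    rw [e, hσ2]
    have h1 : 0 < μ * x * Real.sinh (μ * x) := by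
      rcases lt_or_gt_of_ne hx with h | h
      · exact mul_pos_of_neg_of_neg (mul_neg_of_pos_of_neg hμ0 h)
          (Real.sinh_neg_iff.2 (mul_neg_of_pos_of_neg hμ0 h))
      · exact mul_pos (mul_pos hμ0 h) (Real.sinh_pos_iff.2 (mul_pos hμ0 h))
    have h2 : 0 < s x ^ 2 := pow_pos (abs_pos.2 (hne x)) 2 |>.trans_eq (sq_abs _)
    positivity
  have hs0 : s 0 = β - σ * α := by simp [hs]
  refine ⟨fun x => (s x)⁻¹, fun x => -s' x / s x ^ 2,
    ⟨fun x => (hds x).inv (hne x), fun x => ?_, by simp [hs'], hmono, ?_, ?_, ?_⟩,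
    fun x => by simp [hs], ?_, ?_⟩
  · have h := ((hds' x).neg).div ((hds x).pow 2) (pow_ne_zero 2 (hne x))
    refine h.congr_deriv ?_
    have h2 := hsq x
    have hsx := hne x
    have ha0 : a ≠ 0 := ha.ne'
    have hd0 : d ≠ 0 := hd.ne'
    have e : -(μ ^ 2 * (s x - β)) * s x ^ 2 - -s' x * (((2 : ℕ) : ℝ) * s x ^ (2 - 1) * s' x)
        = μ ^ 2 * (s x ^ 3 - 3 * β * s x ^ 2 - s x / a) := by
      have : -(μ ^ 2 * (s x - β)) * s x ^ 2 - -s' x * (((2 : ℕ) : ℝ) * s x ^ (2 - 1) * s' x)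
        = -(μ ^ 2 * (s x - β)) * s x ^ 2 + 2 * s x * s' x ^ 2 := by push_cast; ring
      rw [this, h2]; field_simp; ring
    simp only [Pi.neg_apply, Pi.pow_apply]
    rw [e, ← ha_def, hβ]
    rw [div_eq_div_iff (by positivity) hd0]
    field_simp
    rw [hμ]
    ring
  · refine ((memLp_two_inv_cosh hμ0).const_mul ((α - |β|)⁻¹)).mono hci.aestronglyMeasurable
      (Eventually.of_forall fun x => ?_)
    rw [Real.norm_eq_abs]
    exact (hbw x).trans (le_abs_self _)
  · refine ((memLp_two_inv_cosh hμ0).const_mul (α * μ * ((α - |β|) ^ 2)⁻¹)).mono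
      ((hcs'.neg.div (hcs.pow 2) fun x => pow_ne_zero 2 (hne x)).aestronglyMeasurable)
      (Eventually.of_forall fun x => ?_)
    refine le_trans ?_ (le_abs_self _)
    have hcp := Real.cosh_pos (μ * x)
    have h1 : |s' x| ≤ α * μ * Real.cosh (μ * x) := by
      simp only [hs']
      rw [abs_neg, abs_mul, abs_mul, abs_mul, hσa, abs_of_pos hα0, abs_of_pos hμ0, one_mul]
      gcongr
      rw [Real.abs_sinh, ← Real.cosh_abs]
      exact (Real.sinh_lt_cosh _).le
    have h2 : ((α - |β|) * Real.cosh (μ * x)) ^ 2 ≤ s x ^ 2 := by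
      rw [← sq_abs (s x)]
      exact pow_le_pow_left₀ (by positivity) (hlow x) 2
    rw [Real.norm_eq_abs, abs_div, abs_neg, abs_of_nonneg (sq_nonneg (s x))]
    calc |s' x| / s x ^ 2 ≤ (α * μ * Real.cosh (μ * x)) / ((α - |β|) * Real.cosh (μ * x)) ^ 2 := by
          gcongr
      _ = _ := by field_simp
  · refine ⟨(α - |β|)⁻¹, fun x => (hbw x).trans ?_⟩
    exact mul_le_of_le_one_right (by positivity) (inv_le_one_of_one_le₀ (Real.one_le_cosh _))
  · have h1 : σ * s 0 < 0 := by
      rw [hs0, mul_sub, ← mul_assoc, ← sq, hσ2, one_mul]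
      have := le_abs_self (σ * β)
      rw [abs_mul, hσa, one_mul] at this
      linarith
    have h2 : σ * (s 0)⁻¹ = (σ * s 0) * ((s 0)⁻¹) ^ 2 := by
      have := hne 0; field_simp
    simp only
    rw [h2]
    have : 0 < ((s 0)⁻¹) ^ 2 := by
      rw [← sq_abs, abs_inv]; exact pow_pos (inv_pos.2 (hpos 0)) 2
    exact mul_neg_of_neg_of_pos h1 this
  · have h1 : s 0 ^ 2 - 2 * β * s 0 - 1 / (2 * a) = 0 := by
      rw [hs0]; linear_combination α ^ 2 * hσ2 + hα
    have h2 := hne 0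
    have ha0 := ha.ne'
    simp only
    rw [hβ]
    field_simp at h1 ⊢
    linear_combination h1

namespace IsPulse

variable {d ζ v σ : ℝ} {w w' : ℝ → ℝ}

lemma continuous (h : IsPulse d ζ v σ w w') : Continuous w :=
  continuous_iff_continuousAt.2 fun x => (h.hasDerivAt x).continuousAt

lemma eq_of_apply_zero_eq {σ' : ℝ} {z z' : ℝ → ℝ} (h : IsPulse d ζ v σ w w')
    (k : IsPulse d ζ v σ' z z') (h0 : w 0 = z 0) (x : ℝ) : w x = z x := by
  have hw := h.continuous
  have hz := k.continuous
  have := eq_zero_of_linear_ode (e := fun x => w x - z x) (e' := fun x => w' x - z' x) (x₀ := 0)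
    (Q := fun x => ((ζ - 3 * v ^ 2) - 3 * v * (w x + z x) - (w x ^ 2 + w x * z x + z x ^ 2)) / d)
    (by fun_prop)
    (fun x => (h.hasDerivAt x).sub (k.hasDerivAt x))
    (fun x => ((h.hasDerivAt' x).sub (k.hasDerivAt' x)).congr_deriv (by ring))
    (sub_eq_zero.2 h0) (by simp only [h.deriv_zero, k.deriv_zero, sub_self]) x
  exact sub_eq_zero.1 this

lemma not_forall_deriv_eq_zero (h : IsPulse d ζ v σ w w') : ¬ ∀ x, w' x = 0 := fun H => by
  have := h.monotone 1 one_ne_zero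
  rw [H] at this
  simp at this

lemma apply_zero_ne_zero (h : IsPulse d ζ v σ w w') : w 0 ≠ 0 := by
  intro h0
  have hw := h.continuous
  have hz : ∀ x, w x = 0 := eq_zero_of_linear_ode (x₀ := 0)
    (Q := fun x => ((ζ - 3 * v ^ 2) - 3 * v * w x - w x ^ 2) / d) (by fun_prop)
    h.hasDerivAt (fun x => (h.hasDerivAt' x).congr_deriv (by ring)) h0 h.deriv_zero
  refine h.not_forall_deriv_eq_zero fun x => ?_
  have h1 := h.hasDerivAt x
  rw [show w = fun _ => 0 from funext hz] at h1
  exact h1.unique (hasDerivAt_const x 0)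

/-- The first integral at `x = 0`. The integration constant vanishes because it is integrable. -/
lemma first_integral (hd : 0 < d) (h : IsPulse d ζ v σ w w') :
    ζ - 3 * v ^ 2 - 2 * v * w 0 - w 0 ^ 2 / 2 = 0 := by
  let E : ℝ → ℝ := fun x =>
    d * w' x ^ 2 - (ζ - 3 * v ^ 2) * w x ^ 2 + 2 * v * w x ^ 3 + w x ^ 4 / 2
  have hE : ∀ x, HasDerivAt E 0 x := by
    intro x
    have := (((((h.hasDerivAt' x).pow 2).const_mul d).sub
      (((h.hasDerivAt x).pow 2).const_mul (ζ - 3 * v ^ 2))).add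
      (((h.hasDerivAt x).pow 3).const_mul (2 * v))).add (((h.hasDerivAt x).pow 4).div_const 2)
    refine this.congr_deriv ?_
    have hd0 := hd.ne'
    push_cast
    field_simp
    ring
  have hconst : ∀ x, E x = E 0 := fun x => is_const_of_deriv_eq_zero
    (fun x => (hE x).differentiableAt) (fun x => (hE x).deriv) x 0
  have hw2 : Integrable fun x => w x ^ 2 := h.memLp.integrable_sq
  obtain ⟨C, hC⟩ := h.bounded
  have hw3 : Integrable fun x => w x * w x ^ 2 := hw2.bdd_mul (c := C)
    h.continuous.aestronglyMeasurable (Eventually.of_forall hC)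
  have hw4 : Integrable fun x => w x * (w x * w x ^ 2) := hw3.bdd_mul (c := C)
    h.continuous.aestronglyMeasurable (Eventually.of_forall hC)
  have hEi : Integrable E := by
    have := (((h.memLp'.integrable_sq.const_mul d).sub (hw2.const_mul (ζ - 3 * v ^ 2))).add
      (hw3.const_mul (2 * v))).add (hw4.div_const 2)
    refine this.congr (Eventually.of_forall fun x => ?_)
    simp only [E, Pi.add_apply, Pi.sub_apply]
    ring
  rw [show E = fun _ => E 0 from funext hconst, integrable_const_iff] at hEi
  have hE0 : E 0 = 0 := by
    rcases hEi with h0 | h0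
    · exact h0
    · exact absurd h0.measure_univ_lt_top (by simp)
  have h2 : w 0 ^ 2 * (ζ - 3 * v ^ 2 - 2 * v * w 0 - w 0 ^ 2 / 2) = 0 := by
    simp only [E, h.deriv_zero] at hE0
    linear_combination -hE0
  exact (mul_eq_zero.1 h2).resolve_left (pow_ne_zero 2 h.apply_zero_ne_zero)

/-- A pulse is determined by its sign. -/
lemma unique (hd : 0 < d) (ha : 0 < ζ - 3 * v ^ 2) (hσ : σ = 1 ∨ σ = -1) {z z' : ℝ → ℝ}
    (h : IsPulse d ζ v σ w w') (k : IsPulse d ζ v σ z z') : w = z := by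
  -- the value at `0` is one of the two roots of a quadratic polynomial, each attained by the
  -- explicit pulse of one sign
  have key : ∀ {y y' : ℝ → ℝ}, IsPulse d ζ v σ y y' → σ * y 0 < 0 := by
    intro y y' hy
    obtain ⟨p, p', hp, -, hp0, hp1⟩ := exists_isPulse (d := d) (σ := -σ) hd ha
      (by rcases hσ with h | h <;> simp [h])
    by_contra hcon
    have hy1 := hy.first_integral hd
    have hyne := hy.apply_zero_ne_zero
    have e : (y 0 - p 0) * (y 0 + p 0 + 4 * v) = 0 := by linear_combination 2 * hp1 - 2 * hy1
    have hσ2 : σ ^ 2 = 1 := by rcases hσ with h | h <;> rw [h] <;> norm_num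
    have heq : y 0 = p 0 := by
      refine sub_eq_zero.1 ((mul_eq_zero.1 e).resolve_right fun h4 => ?_)
      have h5 : y 0 * p 0 = -(2 * (ζ - 3 * v ^ 2)) := by
        have : p 0 = -(4 * v) - y 0 := by linarith
        rw [this]; linear_combination 2 * hy1
      have h6 : 0 ≤ (σ * y 0) * (σ * p 0) := mul_nonneg (not_lt.1 hcon) (by linarith)
      have h7 : (σ * y 0) * (σ * p 0) = σ ^ 2 * (y 0 * p 0) := by ring
      rw [h7, hσ2, h5] at h6
      linarith
    have hyp : y = p := funext (hy.eq_of_apply_zero_eq hp heq)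
    have hyp' : y' 1 = p' 1 := (hy.hasDerivAt 1).unique (hyp ▸ hp.hasDerivAt 1)
    have m1 := hy.monotone 1 one_ne_zero
    have m2 := hp.monotone 1 one_ne_zero
    rw [hyp'] at m1
    linarith
  have hw1 := h.first_integral hd
  have hz1 := k.first_integral hd
  have e : (w 0 - z 0) * (w 0 + z 0 + 4 * v) = 0 := by linear_combination 2 * hz1 - 2 * hw1
  refine funext (h.eq_of_apply_zero_eq k (sub_eq_zero.1 ((mul_eq_zero.1 e).resolve_right ?_)))
  intro h4
  have h5 : w 0 * z 0 = -(2 * (ζ - 3 * v ^ 2)) := by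
    have : z 0 = -(4 * v) - w 0 := by linarith
    rw [this]; linear_combination 2 * hw1
  have h6 : 0 < (σ * w 0) * (σ * z 0) := mul_pos_of_neg_of_neg (key h) (key k)
  have hσ2 : σ ^ 2 = 1 := by rcases hσ with h | h <;> rw [h] <;> norm_num
  have h7 : (σ * w 0) * (σ * z 0) = σ ^ 2 * (w 0 * z 0) := by ring
  rw [h7, hσ2, h5] at h6
  linarith

end IsPulse

/-! ### Nondegeneracy of the pulse -/

lemma tendsto_zero_of_memLp_two {u u' : ℝ → ℝ} (hd : ∀ x, HasDerivAt u (u' x) x)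
    (hu : MemLp u 2 (volume : Measure ℝ)) (hu' : MemLp u' 2 (volume : Measure ℝ)) :
    Tendsto u atTop (𝓝 0) := by
  have h1 : Tendsto (fun x => u x ^ 2) atTop (𝓝 0) := by
    refine tendsto_zero_of_hasDerivAt_of_integrableOn_Ioi (a := 0)
      (f' := fun x => 2 * (u x * u' x)) (fun x _ => ?_) ?_ hu.integrable_sq.integrableOn
    · exact ((hd x).pow 2).congr_deriv (by push_cast; ring)
    · exact ((hu.integrable_mul hu').const_mul 2).integrableOn
  have h2 := (Real.continuous_sqrt.tendsto 0).comp h1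
  rw [Real.sqrt_zero] at h2
  rw [tendsto_zero_iff_abs_tendsto_zero]
  refine h2.congr fun x => ?_
  simp [Function.comp, Real.sqrt_sq_eq_abs]

lemma memLp_two_of_bounded_mul {u b : ℝ → ℝ} (hu : MemLp u 2 (volume : Measure ℝ))
    (hb : Continuous b) {C : ℝ} (hC : ∀ x, |b x| ≤ C) :
    MemLp (fun x => b x * u x) 2 (volume : Measure ℝ) := by
  refine (hu.const_mul C).mono (hb.aestronglyMeasurable.mul hu.aestronglyMeasurable)
    (Eventually.of_forall fun x => ?_)
  rw [norm_mul, norm_mul]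
  gcongr
  exact (hC x).trans (le_abs_self C)

namespace IsPulse

variable {d ζ v σ : ℝ} {w w' : ℝ → ℝ}

/-- The derivative of a pulse solves the linearized equation. -/
lemma hasDerivAt_deriv2 (h : IsPulse d ζ v σ w w') (x : ℝ) :
    HasDerivAt (fun x => ((ζ - 3 * v ^ 2) * w x - 3 * v * w x ^ 2 - w x ^ 3) / d)
      ((ζ - 3 * (v + w x) ^ 2) / d * w' x) x := by
  have := ((((h.hasDerivAt x).const_mul (ζ - 3 * v ^ 2)).sub
    (((h.hasDerivAt x).pow 2).const_mul (3 * v))).sub ((h.hasDerivAt x).pow 3)).div_const d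
  exact this.congr_deriv (by push_cast; ring)

lemma memLp_deriv2 (h : IsPulse d ζ v σ w w') :
    MemLp (fun x => ((ζ - 3 * v ^ 2) * w x - 3 * v * w x ^ 2 - w x ^ 3) / d) 2
      (volume : Measure ℝ) := by
  obtain ⟨C, hC⟩ := h.bounded
  have hw := h.continuous
  have := memLp_two_of_bounded_mul (C := (|ζ - 3 * v ^ 2| + |3 * v| * C + C ^ 2) / |d|)
    (b := fun x => ((ζ - 3 * v ^ 2) - 3 * v * w x - w x ^ 2) / d) h.memLp (by fun_prop) fun x => by
      rw [abs_div]
      gcongr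
      refine (abs_sub _ _).trans (add_le_add ((abs_sub _ _).trans (add_le_add le_rfl ?_)) ?_)
      · rw [abs_mul]; gcongr; exact hC x
      · rw [abs_pow]; gcongr; exact hC x
  exact this.congr_norm (by fun_prop : Continuous _).aestronglyMeasurable
    (Eventually.of_forall fun x => congrArg norm (by ring))

/-- The Wronskian of a pulse derivative with a solution of `u'' = Q u`. -/
lemma hasDerivAt_wronskian (h : IsPulse d ζ v σ w w') {Q u u' : ℝ → ℝ}
    (hu : ∀ x, HasDerivAt u (u' x) x) (hu' : ∀ x, HasDerivAt u' (Q x * u x) x) (x : ℝ) :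
    HasDerivAt (fun x => w' x * u' x
        - ((ζ - 3 * v ^ 2) * w x - 3 * v * w x ^ 2 - w x ^ 3) / d * u x)
      ((Q x - (ζ - 3 * (v + w x) ^ 2) / d) * (w' x * u x)) x :=
  (((h.hasDerivAt' x).mul (hu' x)).sub ((h.hasDerivAt_deriv2 x).mul (hu x))).congr_deriv (by ring)

lemma integrable_wronskian (h : IsPulse d ζ v σ w w') {u u' : ℝ → ℝ}
    (hu2 : MemLp u 2 (volume : Measure ℝ)) (hu2' : MemLp u' 2 (volume : Measure ℝ)) :
    Integrable (fun x => w' x * u' x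
        - ((ζ - 3 * v ^ 2) * w x - 3 * v * w x ^ 2 - w x ^ 3) / d * u x) :=
  (h.memLp'.integrable_mul hu2').sub (h.memLp_deriv2.integrable_mul hu2)

/-- The linearization along the pulse has no even kernel: the kernel is spanned by the odd
function `w'`. -/
lemma eq_zero_of_linearized_im (h : IsPulse d ζ v σ w w') {q q' : ℝ → ℝ}
    (hq : ∀ x, HasDerivAt q (q' x) x)
    (hq' : ∀ x, HasDerivAt q' ((ζ - 3 * (v + w x) ^ 2) / d * q x) x) (h0 : q' 0 = 0)
    (hq2 : MemLp q 2 (volume : Measure ℝ)) (hq2' : MemLp q' 2 (volume : Measure ℝ)) (x : ℝ) :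
    q x = 0 := by
  have hw := h.continuous
  have hQ : Continuous fun x => (ζ - 3 * (v + w x) ^ 2) / d := by fun_prop
  set W : ℝ → ℝ := fun x => w' x * q' x
    - ((ζ - 3 * v ^ 2) * w x - 3 * v * w x ^ 2 - w x ^ 3) / d * q x with hW
  have hWd : ∀ x, HasDerivAt W 0 x := fun x =>
    (h.hasDerivAt_wronskian hq hq' x).congr_deriv (by ring)
  have hWc : ∀ x, W x = W 0 := fun x => is_const_of_deriv_eq_zero
    (fun x => (hWd x).differentiableAt) (fun x => (hWd x).deriv) x 0
  have hWi : Integrable W := h.integrable_wronskian hq2 hq2'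
  rw [show W = fun _ => W 0 from funext hWc, integrable_const_iff] at hWi
  have hW0 : W 0 = 0 := hWi.resolve_right fun h0 => absurd h0.measure_univ_lt_top (by simp)
  simp only [hW, h.deriv_zero, zero_mul, zero_sub, neg_eq_zero] at hW0
  refine eq_zero_of_linear_ode hQ hq hq' ((mul_eq_zero.1 hW0).resolve_left fun h2 => ?_) h0 x
  exact h.not_forall_deriv_eq_zero (eq_zero_of_linear_ode hQ h.hasDerivAt' h.hasDerivAt_deriv2
    h.deriv_zero h2)

/-- The other component of the linearization, `-d ∂² + ζ - y²` with `y = v + w`, has no even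
kernel either. A nonzero solution `p` has no positive zero, by comparison with `w'`, so it has a
sign on `(0, ∞)`; but it is orthogonal to the constants there, because `y` solves
`-d y'' + (ζ - y²) y = -f` and `f ≠ 0`. -/
lemma eq_zero_of_linearized_re (hd : 0 < d) (h : IsPulse d ζ v σ w w') (hf : -ζ * v + v ^ 3 ≠ 0)
    {p p' : ℝ → ℝ} (hp : ∀ x, HasDerivAt p (p' x) x)
    (hp' : ∀ x, HasDerivAt p' ((ζ - (v + w x) ^ 2) / d * p x) x) (h0 : p' 0 = 0)
    (hp2 : MemLp p 2 (volume : Measure ℝ)) (hp2' : MemLp p' 2 (volume : Measure ℝ)) (x : ℝ) :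
    p x = 0 := by
  have hw := h.continuous
  have hpc : Continuous p := continuous_iff_continuousAt.2 fun x => (hp x).continuousAt
  have hQ : Continuous fun x => (ζ - (v + w x) ^ 2) / d := by fun_prop
  obtain ⟨C, hC⟩ := h.bounded
  have hyC : ∀ x, |v + w x| ≤ |v| + C := fun x =>
    (abs_add_le _ _).trans (add_le_add le_rfl (hC x))
  set W : ℝ → ℝ := fun x => w' x * p' x
    - ((ζ - 3 * v ^ 2) * w x - 3 * v * w x ^ 2 - w x ^ 3) / d * p x with hW
  have hWd : ∀ x, HasDerivAt W (2 * (v + w x) ^ 2 / d * (w' x * p x)) x := fun x =>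
    (h.hasDerivAt_wronskian hp hp' x).congr_deriv (by ring)
  have hWlim : Tendsto W atTop (𝓝 0) := by
    refine tendsto_zero_of_hasDerivAt_of_integrableOn_Ioi (a := 0) (fun x _ => hWd x) ?_
      (h.integrable_wronskian hp2 hp2').integrableOn
    refine ((h.memLp'.integrable_mul hp2).bdd_mul (c := 2 * (|v| + C) ^ 2 / d)
      (by fun_prop : Continuous fun x => 2 * (v + w x) ^ 2 / d).aestronglyMeasurable
      (Eventually.of_forall fun x => ?_)).integrableOn
    rw [Real.norm_of_nonneg (by positivity)]
    have hsq : (v + w x) ^ 2 ≤ (|v| + C) ^ 2 := by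
      rw [← sq_abs]
      exact pow_le_pow_left₀ (abs_nonneg _) (hyC x) 2
    gcongr
  have hwne : ∀ x, 0 < x → w' x ≠ 0 := fun x hx h0 => by
    have := h.monotone x hx.ne'
    rw [h0] at this
    simp at this
  by_contra hpx
  -- comparison with `w'`: beyond a zero of `p`, the square of the Wronskian increases
  have hnz : ∀ x₀, 0 < x₀ → p x₀ ≠ 0 := by
    intro x₀ hx₀ hpx₀
    refine hpx (eq_zero_of_linear_ode hQ hp hp' hpx₀ ?_ x)
    have hEd : ∀ x, 0 < x → HasDerivAt (fun x => W x * (p x / w' x))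
        (2 * (v + w x) ^ 2 / d * p x ^ 2 + (W x / w' x) ^ 2) x := by
      intro x hx
      refine ((hWd x).mul ((hp x).div (h.hasDerivAt' x) (hwne x hx))).congr_deriv ?_
      have h1 : p' x * w' x - p x *
          (((ζ - 3 * v ^ 2) * w x - 3 * v * w x ^ 2 - w x ^ 3) / d) = W x := by
        simp only [hW]; ring
      have h2 := hwne x hx
      simp only [Pi.div_apply]
      rw [h1]
      field_simp
    have hE : ∀ x ∈ Ici x₀, 0 ≤ W x * (p x / w' x) := by
      have hm : MonotoneOn (fun x => W x * (p x / w' x)) (Ici x₀) := by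
        refine monotoneOn_of_deriv_nonneg (convex_Ici x₀)
          (fun x hx => (hEd x (hx₀.trans_le hx)).continuousAt.continuousWithinAt)
          (fun x hx => ?_) fun x hx => ?_
        · rw [interior_Ici] at hx
          exact (hEd x (hx₀.trans hx)).differentiableAt.differentiableWithinAt
        · rw [interior_Ici] at hx
          rw [(hEd x (hx₀.trans hx)).deriv]
          positivity
      intro x hx
      have := hm self_mem_Ici hx hx
      simpa [hpx₀] using this
    have hW2 : MonotoneOn (fun x => W x ^ 2) (Ici x₀) := by
      refine monotoneOn_of_deriv_nonneg (convex_Ici x₀)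
        (fun x _ => ((hWd x).pow 2).continuousAt.continuousWithinAt)
        (fun x _ => ((hWd x).pow 2).differentiableAt.differentiableWithinAt) fun x hx => ?_
      rw [interior_Ici] at hx
      have h2 := hwne x (hx₀.trans hx)
      have e : deriv (fun x => W x ^ 2) x
          = 4 * (v + w x) ^ 2 / d * w' x ^ 2 * (W x * (p x / w' x)) := by
        rw [((hWd x).fun_pow 2).deriv]
        push_cast
        field_simp
        ring
      rw [e]
      exact mul_nonneg (by positivity) (hE x (Ioi_subset_Ici_self hx))
    have hlim2 : Tendsto (fun x => W x ^ 2) atTop (𝓝 0) := by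
      simpa using hWlim.pow 2
    have hle : W x₀ ^ 2 ≤ 0 := ge_of_tendsto hlim2 (by
      filter_upwards [eventually_ge_atTop x₀] with x hx using hW2 self_mem_Ici hx hx)
    have hW0 : W x₀ = 0 := pow_eq_zero_iff (two_ne_zero) |>.1 (le_antisymm hle (sq_nonneg _))
    simp only [hW, hpx₀, mul_zero, sub_zero] at hW0
    exact (mul_eq_zero.1 hW0).resolve_left (hwne x₀ hx₀)
  have hsign : ∃ s : ℝ, ∀ x, 0 < x → 0 < s * (-(-ζ * v + v ^ 3) / d * p x) := by
    refine ⟨-(-ζ * v + v ^ 3) / d * p 1, fun x hx => ?_⟩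
    have hc0 : -(-ζ * v + v ^ 3) / d ≠ 0 := div_ne_zero (neg_ne_zero.2 hf) hd.ne'
    have hpp : 0 < p 1 * p x := by
      by_contra hcon
      have h1 : (0 : ℝ) ∈ uIcc (p 1) (p x) := by
        rw [mem_uIcc]
        rcases lt_or_gt_of_ne (hnz 1 one_pos) with h1 | h1
        · exact Or.inl ⟨h1.le, by nlinarith⟩
        · exact Or.inr ⟨by nlinarith, h1.le⟩
      obtain ⟨t, ht, ht0⟩ := intermediate_value_uIcc hpc.continuousOn h1
      have ht' : 0 < t := (lt_min one_pos hx).trans_le ht.1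
      exact hnz t ht' ht0
    have e : -(-ζ * v + v ^ 3) / d * p 1 * (-(-ζ * v + v ^ 3) / d * p x)
        = (-(-ζ * v + v ^ 3) / d) ^ 2 * (p 1 * p x) := by ring
    rw [e]
    exact mul_pos (by positivity) hpp
  obtain ⟨s, hs⟩ := hsign
  set X : ℝ → ℝ := fun x => (v + w x) * p' x - w' x * p x with hX
  have hXd : ∀ x, HasDerivAt (fun x => s * X x) (s * (-(-ζ * v + v ^ 3) / d * p x)) x := by
    intro x
    refine (((((h.hasDerivAt x).const_add v).mul (hp' x)).sub
      ((h.hasDerivAt' x).mul (hp x))).const_mul s).congr_deriv ?_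
    have := hd.ne'
    field_simp
    ring
  have hX0 : X 0 = 0 := by simp [hX, h0, h.deriv_zero]
  have hmono : StrictMonoOn (fun x => s * X x) (Ici 0) := by
    refine strictMonoOn_of_deriv_pos (convex_Ici 0)
      (fun x _ => (hXd x).continuousAt.continuousWithinAt) fun x hx => ?_
    rw [interior_Ici] at hx
    rw [(hXd x).deriv]
    exact hs x hx
  have hp2'' : MemLp (fun x => (ζ - (v + w x) ^ 2) / d * p x) 2 (volume : Measure ℝ) :=
    memLp_two_of_bounded_mul (C := (|ζ| + (|v| + C) ^ 2) / |d|) hp2 hQ fun x => by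
      rw [abs_div]
      gcongr
      refine (abs_sub _ _).trans (add_le_add le_rfl ?_)
      rw [abs_pow]
      gcongr
      exact hyC x
  have hXlim : Tendsto (fun x => s * X x) atTop (𝓝 0) := by
    have l1 := tendsto_zero_of_memLp_two h.hasDerivAt h.memLp h.memLp'
    have l2 := tendsto_zero_of_memLp_two h.hasDerivAt' h.memLp' h.memLp_deriv2
    have l3 := tendsto_zero_of_memLp_two hp hp2 hp2'
    have l4 := tendsto_zero_of_memLp_two hp' hp2' hp2''
    have := (((l1.const_add v).mul l4).sub (l2.mul l3)).const_mul s
    simpa using this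
  have h1 : s * X 0 < s * X 1 := hmono self_mem_Ici (mem_Ici.2 zero_le_one) one_pos
  rw [hX0, mul_zero] at h1
  have h2 : s * X 1 ≤ 0 := ge_of_tendsto hXlim (by
    filter_upwards [eventually_ge_atTop 1] with x hx
    exact hmono.monotoneOn (mem_Ici.2 zero_le_one) (mem_Ici.2 (zero_le_one.trans hx)) hx)
  linarith

end IsPulse

/-! ### The constant states and the homoclinic solutions -/

lemma exists_roots {ζ f : ℝ} (hζ : 0 < ζ) (hf : |f| < 2 * √3 / 9 * ζ ^ (3 / 2 : ℝ)) :
    ∃ v₁ v₂ v₃ : ℝ, v₁ < v₂ ∧ v₂ < v₃ ∧ (∀ v : ℝ, -ζ * v + v ^ 3 = f ↔ v = v₁ ∨ v = v₂ ∨ v = v₃) ∧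
      0 < ζ - 3 * v₂ ^ 2 := by
  -- `± r` are the critical points of the cubic polynomial
  set r : ℝ := √(ζ / 3) with hr
  have hr0 : 0 < r := Real.sqrt_pos.2 (by positivity)
  have hr2 : r ^ 2 = ζ / 3 := Real.sq_sqrt (by positivity)
  have hbound : 2 * √3 / 9 * ζ ^ (3 / 2 : ℝ) = 2 * r ^ 3 := by
    have h1 : ζ ^ (3 / 2 : ℝ) = √ζ ^ 3 := by
      rw [Real.sqrt_eq_rpow, ← Real.rpow_natCast, ← Real.rpow_mul hζ.le]; norm_num
    have h3 : √3 ^ 2 = 3 := Real.sq_sqrt (by norm_num)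
    have h30 : 0 < √3 := by positivity
    rw [h1, hr, Real.sqrt_div hζ.le, div_pow, show √3 ^ 3 = 3 * √3 by rw [pow_succ, h3]]
    field_simp
    linear_combination 3 * h3
  rw [hbound, abs_lt] at hf
  obtain ⟨v, hv, hv0⟩ : (0 : ℝ) ∈ (fun v : ℝ => -ζ * v + v ^ 3 - f) '' Ioo (-r) r := by
    refine intermediate_value_Ioo' (by linarith) (by fun_prop) ⟨?_, ?_⟩
    · nlinarith
    · nlinarith
  have hv2 : 3 * v ^ 2 < ζ := by
    have := sq_lt_sq' hv.1 hv.2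
    linarith
  simp only at hv0
  set D : ℝ := √(4 * ζ - 3 * v ^ 2) with hD
  have hD2 : D ^ 2 = 4 * ζ - 3 * v ^ 2 := Real.sq_sqrt (by nlinarith [sq_nonneg v])
  have hD0 : 0 ≤ D := Real.sqrt_nonneg _
  have hvD : |3 * v| < D := abs_lt_of_sq_lt_sq (by rw [hD2]; nlinarith) hD0
  rw [abs_lt] at hvD
  refine ⟨(-v - D) / 2, v, (-v + D) / 2, by linarith, by linarith, fun z => ?_, by linarith⟩
  have e : -ζ * z + z ^ 3 - f = (z - (-v - D) / 2) * ((z - v) * (z - (-v + D) / 2)) := by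
    linear_combination hv0 + (z - v) / 4 * hD2
  rw [← sub_eq_zero, e, mul_eq_zero, mul_eq_zero, sub_eq_zero, sub_eq_zero, sub_eq_zero]

lemma exists_H2Even {w w' w'' : ℝ → ℝ} (h : ∀ x, HasDerivAt w (w' x) x)
    (h' : ∀ x, HasDerivAt w' (w'' x) x) (hw : MemLp w 2 (volume : Measure ℝ))
    (hw' : MemLp w' 2 (volume : Measure ℝ)) (hw'' : MemLp w'' 2 (volume : Measure ℝ))
    (heven : ∀ x, w (-x) = w x) :
    ∃ w₀ : H2Even, ∀ᵐ x : ℝ, toL2 w₀ x = Complex.I * w x := by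
  have m0 : MemLp (fun x => Complex.I * (w x : ℂ)) 2 (volume : Measure ℝ) :=
    hw.ofReal.const_mul Complex.I
  have m1 : MemLp (fun x => Complex.I * (w' x : ℂ)) 2 (volume : Measure ℝ) :=
    hw'.ofReal.const_mul Complex.I
  have m2 : MemLp (fun x => Complex.I * (w'' x : ℂ)) 2 (volume : Measure ℝ) :=
    hw''.ofReal.const_mul Complex.I
  obtain ⟨t0, e0⟩ : ∃ t : L2, ∀ᵐ x : ℝ, t x = Complex.I * (w x : ℂ) := ⟨m0.toLp _, m0.coeFn_toLp⟩
  obtain ⟨t1, e1⟩ : ∃ t : L2, ∀ᵐ x : ℝ, t x = Complex.I * (w' x : ℂ) := ⟨m1.toLp _, m1.coeFn_toLp⟩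
  obtain ⟨t2, e2⟩ : ∃ t : L2, ∀ᵐ x : ℝ, t x = Complex.I * (w'' x : ℂ) := ⟨m2.toLp _, m2.coeFn_toLp⟩
  have d0 : IsWeakDeriv t0 t1 := isWeakDeriv_of_hasDerivAt e0 e1 fun x =>
    ((h x).ofReal_comp).const_mul Complex.I
  have d1 : IsWeakDeriv t1 t2 := isWeakDeriv_of_hasDerivAt e1 e2 fun x =>
    ((h' x).ofReal_comp).const_mul Complex.I
  have ev : IsEven t0 := by
    filter_upwards [e0, ae_neg e0] with x h1 h2
    rw [h1, h2, heven]
  exact ⟨⟨WithLp.toLp 2 ![t0, t1, t2], d0, d1, ev⟩, e0⟩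

lemma hasDerivAt_im {F : ℝ → ℂ} {F' : ℂ} {x : ℝ} (h : HasDerivAt F F' x) :
    HasDerivAt (fun x => (F x).im) F'.im x :=
  Complex.imCLM.hasFDerivAt.comp_hasDerivAt x h

lemma hasDerivAt_re {F : ℝ → ℂ} {F' : ℂ} {x : ℝ} (h : HasDerivAt F F' x) :
    HasDerivAt (fun x => (F x).re) F'.re x :=
  Complex.reCLM.hasFDerivAt.comp_hasDerivAt x h

lemma IsPulse.exists_H2Even {d ζ v σ : ℝ} {w w' : ℝ → ℝ} (h : IsPulse d ζ v σ w w')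
    (heven : ∀ x, w (-x) = w x) : ∃ w₀ : H2Even, ∀ᵐ x : ℝ, toL2 w₀ x = Complex.I * w x :=
  LugiatoLefever.exists_H2Even h.hasDerivAt h.hasDerivAt' h.memLp h.memLp' h.memLp_deriv2 heven

lemma IsPulse.isHomoclinic {d ζ f v σ : ℝ} (hd : 0 < d) (hv : -ζ * v + v ^ 3 = f)
    {w w' : ℝ → ℝ} (h : IsPulse d ζ v σ w w') (heven : ∀ x, w (-x) = w x) :
    IsHomoclinic d ζ f v σ fun x => Complex.I * (v + w x : ℝ) := by
  have hu : ∀ x, HasDerivAt (fun x => Complex.I * ((v + w x : ℝ) : ℂ)) (Complex.I * (w' x : ℂ)) x :=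
    fun x => (((h.hasDerivAt x).const_add v).ofReal_comp).const_mul Complex.I
  have hu' : ∀ x, HasDerivAt (fun x => Complex.I * (w' x : ℂ))
      (Complex.I * ((((ζ - 3 * v ^ 2) * w x - 3 * v * w x ^ 2 - w x ^ 3) / d : ℝ) : ℂ)) x :=
    fun x => ((h.hasDerivAt' x).ofReal_comp).const_mul Complex.I
  have hw := h.continuous
  have e1 : deriv (fun x => Complex.I * ((v + w x : ℝ) : ℂ)) = fun x => Complex.I * (w' x : ℂ) :=
    funext fun x => (hu x).deriv
  have e2 : deriv (fun x => Complex.I * (w' x : ℂ)) = fun x =>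
      Complex.I * ((((ζ - 3 * v ^ 2) * w x - 3 * v * w x ^ 2 - w x ^ 3) / d : ℝ) : ℂ) :=
    funext fun x => (hu' x).deriv
  refine ⟨?_, fun x => by simp only [heven], fun x => by simp, ?_, fun x => ?_, fun x hx => ?_, ?_⟩
  · rw [show (2 : WithTop ℕ∞) = 1 + 1 by norm_num, contDiff_succ_iff_deriv]
    refine ⟨fun x => (hu x).differentiableAt, by simp, ?_⟩
    rw [e1, contDiff_one_iff_deriv, e2]
    exact ⟨fun x => (hu' x).differentiableAt, by fun_prop⟩
  · rw [e1]; simp [h.deriv_zero]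
  · rw [e1, e2, norm_mul, Complex.norm_I, one_mul, Complex.norm_real, ← Complex.ofReal_pow,
      Real.norm_eq_abs, sq_abs, ← hv]
    have hd0 : (d : ℂ) ≠ 0 := Complex.ofReal_ne_zero.2 hd.ne'
    push_cast
    field_simp
    ring
  · rw [e1]
    simpa using h.monotone x hx
  · obtain ⟨w₀, hw₀⟩ := h.exists_H2Even heven
    refine ⟨w₀, ?_⟩
    filter_upwards [hw₀] with x hx
    rw [hx]; push_cast; ring

/-- The imaginary part of a homoclinic solution is a constant plus a pulse. -/
lemma IsHomoclinic.isPulse {d ζ f v σ : ℝ} (hd : 0 < d) (hv : -ζ * v + v ^ 3 = f) {u : ℝ → ℂ}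
    (h : IsHomoclinic d ζ f v σ u) :
    IsPulse d ζ v σ (fun x => (u x).im - v) fun x => (deriv u x).im := by
  obtain ⟨w₀, hw₀⟩ := h.tail
  have hu := h.contDiff
  rw [show (2 : WithTop ℕ∞) = 1 + 1 by norm_num, contDiff_succ_iff_deriv,
    contDiff_one_iff_deriv] at hu
  obtain ⟨hu1, -, hu2, -⟩ := hu
  have hval : val w₀ = fun x => u x - Complex.I * v :=
    val_eq_of_ae (h.contDiff.continuous.sub continuous_const) hw₀
  have hder : der w₀ = deriv u := by
    funext x
    have h1 := hasDerivAt_val w₀ x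
    rw [hval] at h1
    exact h1.unique ((hu1 x).hasDerivAt.sub_const _)
  have him : (fun x => (u x).im - v) = fun x => (val w₀ x).im := by
    rw [hval]; funext x; simp
  refine ⟨fun x => (hasDerivAt_im (hu1 x).hasDerivAt).sub_const v, fun x => ?_, ?_, h.monotone,
    ?_, ?_, ⟨2 * ‖w₀‖, fun x => ?_⟩⟩
  · have h1 := hasDerivAt_im (hu2 x).hasDerivAt
    refine h1.congr_deriv ?_
    have hux : u x = Complex.I * ((u x).im : ℂ) := by
      apply Complex.ext <;> simp [h.imaginary x]
    have h2 := congrArg Complex.im (h.equation x)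
    have h3 : ((‖u x‖ : ℂ) ^ 2 * u x).im = (u x).im ^ 3 := by
      have key : ∀ t : ℝ, ((‖Complex.I * (t : ℂ)‖ : ℂ) ^ 2 * (Complex.I * (t : ℂ))).im = t ^ 3 := by
        intro t
        rw [norm_mul, Complex.norm_I, one_mul, Complex.norm_real, ← Complex.ofReal_pow,
          Real.norm_eq_abs, sq_abs, show ((t ^ 2 : ℝ) : ℂ) * (Complex.I * (t : ℂ))
            = Complex.I * ((t ^ 3 : ℝ) : ℂ) by push_cast; ring, Complex.I_mul_im, Complex.ofReal_re]
      have h4 := key (u x).im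
      rwa [← hux] at h4
    rw [eq_div_iff hd.ne']
    simp only [Complex.add_im, Complex.sub_im, h3] at h2
    simp at h2
    rw [← hv] at h2
    linear_combination -h2
  · simp only [h.deriv_zero, Complex.zero_im]
  · rw [him]; exact (memLp_val w₀).im
  · rw [← hder]; exact (memLp_der w₀).im
  · rw [congrFun him x]
    exact (Complex.abs_im_le_norm _).trans (norm_val_le w₀ x)

lemma IsHomoclinic.unique {d ζ f v σ : ℝ} (hd : 0 < d) (hv : -ζ * v + v ^ 3 = f)
    (ha : 0 < ζ - 3 * v ^ 2) (hσ : σ = 1 ∨ σ = -1) {w w' : ℝ → ℝ} (hw : IsPulse d ζ v σ w w')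
    {u : ℝ → ℂ} (h : IsHomoclinic d ζ f v σ u) : u = fun x => Complex.I * (v + w x : ℝ) := by
  have := (h.isPulse hd hv).unique hd ha hσ hw
  funext x
  rw [← this]
  apply Complex.ext <;> simp [h.imaginary x]

/-! ### Implicit functions -/

/-- The implicit function theorem, with a fixed neighborhood in which the solution is unique and a
solution depending continuously on the parameter in a whole neighborhood. -/
lemma exists_unique_continuation {P E F : Type*} [NormedAddCommGroup P] [NormedSpace ℝ P]
    [CompleteSpace P] [NormedAddCommGroup E] [NormedSpace ℝ E] [CompleteSpace E]
    [NormedAddCommGroup F] [NormedSpace ℝ F] [CompleteSpace F] {f : P × E → F} {f' : P × E →L[ℝ] F}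
    {p₀ : P} {w₀ : E} (hf : HasStrictFDerivAt f f' (p₀, w₀)) (h0 : f (p₀, w₀) = 0)
    (hbij : Function.Bijective fun h : E => f' (0, h)) :
    ∃ (J : Set P) (U : Set E) (φ : P → E), IsOpen J ∧ p₀ ∈ J ∧ IsOpen U ∧ w₀ ∈ U ∧
      ContinuousOn φ J ∧ ∀ p ∈ J, ∀ w, (w ∈ U ∧ f (p, w) = 0) ↔ w = φ p := by
  have hinv : (f' ∘L .inr ℝ P E).IsInvertible := by
    refine ⟨ContinuousLinearEquiv.ofBijective (f' ∘L .inr ℝ P E) ?_ ?_, rfl⟩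
    · exact LinearMap.ker_eq_bot.2 hbij.1
    · exact LinearMap.range_eq_top.2 hbij.2
  let D := hf.implicitFunctionDataOfProdDomain hinv
  let ψ := D.toOpenPartialHomeomorph
  have hψ : ∀ x, ψ x = (f x, x.1) := fun x => rfl
  have hmem : (p₀, w₀) ∈ ψ.source := D.pt_mem_toOpenPartialHomeomorph_source
  obtain ⟨A, U, hA, hU, hpA, hwU, hAU⟩ := isOpen_prod_iff.1 ψ.open_source p₀ w₀ hmem
  let ι : P → F × P := fun p => (0, p)
  have hι : Continuous ι := by fun_prop
  have hO : IsOpen (ψ.target ∩ ψ.symm ⁻¹' (A ×ˢ U)) :=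
    ψ.symm.isOpen_inter_preimage (hA.prod hU)
  refine ⟨ι ⁻¹' (ψ.target ∩ ψ.symm ⁻¹' (A ×ˢ U)), U, fun p => (ψ.symm (ι p)).2,
    hO.preimage hι, ?_, hU, hwU, ?_, fun p hp w => ⟨fun h => ?_, fun h => ?_⟩⟩
  · have e : ι p₀ = ψ (p₀, w₀) := by rw [hψ, h0]
    refine ⟨?_, ?_⟩
    · rw [e]; exact ψ.map_source hmem
    · rw [mem_preimage, e, ψ.left_inv hmem]; exact ⟨hpA, hwU⟩
  · exact continuous_snd.comp_continuousOn (ψ.continuousOn_symm.comp hι.continuousOn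
      fun p hp => hp.1)
  · have hs : ψ (ψ.symm (ι p)) = ι p := ψ.right_inv hp.1
    rw [hψ] at hs
    have hpA' : p ∈ A := by
      have := hp.2.1
      rwa [show (ψ.symm (ι p)).1 = p from congrArg Prod.snd hs] at this
    have h1 : ψ.symm (ψ (p, w)) = (p, w) := ψ.left_inv (hAU ⟨hpA', h.1⟩)
    rw [hψ, h.2] at h1
    exact (congrArg Prod.snd h1).symm
  · have hs : ψ (ψ.symm (ι p)) = ι p := ψ.right_inv hp.1
    rw [hψ] at hs
    have h1 : (ψ.symm (ι p)).1 = p := congrArg Prod.snd hs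
    have h2 : f (ψ.symm (ι p)) = 0 := congrArg Prod.fst hs
    rw [h]
    refine ⟨hp.2.2, ?_⟩
    rw [← h2]
    congr 1
    exact Prod.ext h1.symm rfl

lemma bijective_diag {m n : ℝ} (hm : m ≠ 0) (hn : n ≠ 0) : Function.Bijective (diagCLM m n) := by
  refine ⟨fun z z' h => ?_, fun z => ⟨⟨m⁻¹ * z.re, n⁻¹ * z.im⟩, ?_⟩⟩
  · rw [diagCLM_apply, diagCLM_apply, Complex.mk.injEq] at h
    exact Complex.ext (mul_left_cancel₀ hm h.1) (mul_left_cancel₀ hn h.2)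
  · rw [diagCLM_apply]
    apply Complex.ext <;> field_simp

lemma sq_norm_mul_eq (z : ℂ) : (‖z‖ : ℂ) ^ 2 * z = z ^ 2 * Complex.conjCLE z := by
  rw [← Complex.mul_conj', Complex.conjCLE_apply]; ring

/-- The constant state `i v` continues uniquely in the parameters `ε` and `κ`. -/
lemma exists_constantState {ζ f v : ℝ} (hv : -ζ * v + v ^ 3 = f) (ha : 0 < ζ - 3 * v ^ 2) :
    ∃ (J₀ : Set (ℝ × ℝ)) (W : Set ℂ) (c : ℝ × ℝ → ℂ), IsOpen J₀ ∧ (0, 0) ∈ J₀ ∧ IsOpen W ∧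
      ContinuousOn c J₀ ∧ c (0, 0) = Complex.I * v ∧
      ∀ p ∈ J₀, ∀ z : ℂ, (z ∈ W ∧ IsConstantState ζ f p.1 p.2 z) ↔ z = c p := by
  let S : (ℝ × ℝ) × ℂ → ℂ := fun x => (ζ - x.1.1 * Complex.I) * x.2
    - (1 + Complex.I * x.1.2) * (x.2 ^ 2 * Complex.conjCLE x.2) + Complex.I * f
  have hS : ∀ p z, S (p, z) = 0 ↔ IsConstantState ζ f p.1 p.2 z := fun p z => by
    simp only [S, IsConstantState]
    rw [← sq_norm_mul_eq, ← mul_assoc]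
  have hcd : ContDiff ℝ 1 S := by
    have h1 : ContDiff ℝ 1 fun x : (ℝ × ℝ) × ℂ => (x.1.1 : ℂ) :=
      Complex.ofRealCLM.contDiff.comp (contDiff_fst.comp contDiff_fst)
    have h2 : ContDiff ℝ 1 fun x : (ℝ × ℝ) × ℂ => (x.1.2 : ℂ) :=
      Complex.ofRealCLM.contDiff.comp (contDiff_snd.comp contDiff_fst)
    have h3 : ContDiff ℝ 1 fun x : (ℝ × ℝ) × ℂ => Complex.conjCLE x.2 :=
      Complex.conjCLE.contDiff.comp contDiff_snd
    fun_prop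
  have hst := hcd.hasStrictFDerivAt (x := ((0, 0), Complex.I * v)) (by norm_num)
  have h00 : IsConstantState ζ f 0 0 (Complex.I * v) := by
    simp only [IsConstantState]
    rw [norm_mul, Complex.norm_I, one_mul, Complex.norm_real, ← Complex.ofReal_pow,
      Real.norm_eq_abs, sq_abs, ← hv]
    push_cast
    ring
  have hder : ∀ h : ℂ, fderiv ℝ S ((0, 0), Complex.I * v) (0, h)
      = diagCLM (ζ - v ^ 2) (ζ - 3 * v ^ 2) h := by
    intro h
    have hz : HasDerivAt (fun t : ℝ => Complex.I * v + t • h) h 0 := by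
      simpa using ((hasDerivAt_id (0 : ℝ)).smul_const h).const_add (Complex.I * (v : ℂ))
    have h1 : HasDerivAt (fun t : ℝ => (((0, 0), Complex.I * v + t • h) : (ℝ × ℝ) × ℂ)) (0, h) 0 :=
      (hasDerivAt_const (0 : ℝ) ((0, 0) : ℝ × ℝ)).prodMk hz
    have h2 : HasDerivAt (fun t : ℝ => S ((0, 0), Complex.I * v + t • h)) _ 0 :=
      HasFDerivAt.comp_hasDerivAt_of_eq (0 : ℝ) hst.hasFDerivAt h1 (by simp)
    have hc : HasDerivAt (fun t : ℝ => Complex.conjCLE (Complex.I * v + t • h))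
        (Complex.conjCLE h) 0 :=
      (Complex.conjCLE : ℂ →L[ℝ] ℂ).hasFDerivAt.comp_hasDerivAt (0 : ℝ) hz
    have h3 := ((hz.const_mul ((ζ : ℂ) - ((0 : ℝ) : ℂ) * Complex.I)).sub
      (((hz.pow 2).mul hc).const_mul (1 + Complex.I * ((0 : ℝ) : ℂ)))).add_const (Complex.I * f)
    refine (h2.unique h3).trans ?_
    rw [diagCLM_apply]
    apply Complex.ext <;> simp [sq] <;> ring
  have hva : ζ - v ^ 2 ≠ 0 := by nlinarith [sq_nonneg v]
  obtain ⟨J, U, φ, hJ, h0J, hU, h0U, hφ, H⟩ := exists_unique_continuation hst ((hS _ _).2 h00)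
    (by simp only [hder]; exact bijective_diag hva ha.ne')
  refine ⟨J, U, φ, hJ, h0J, hU, hφ, ((H _ h0J _).1 ⟨h0U, (hS _ _).2 h00⟩).symm, fun p hp z => ?_⟩
  rw [← hS]
  exact H p hp z

/-! ### The perturbed equation as a map between Banach spaces -/

/-- The Banach algebra `L^∞(ℝ; ℂ)`. -/
abbrev Linfty : Type := Lp ℂ ⊤ (volume : Measure ℝ)

/-- The product `L^∞ × L^∞ → L^∞`. -/
def mulInfty : Linfty →L[ℝ] Linfty →L[ℝ] Linfty :=
  (ContinuousLinearMap.mul ℝ ℂ).holderL volume ⊤ ⊤ ⊤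

/-- The product `L^∞ × L² → L²`. -/
def mulL2 : Linfty →L[ℝ] L2 →L[ℝ] L2 :=
  (ContinuousLinearMap.mul ℝ ℂ).holderL volume ⊤ 2 2

lemma mulInfty_ae (a b : Linfty) : ∀ᵐ x : ℝ, mulInfty a b x = a x * b x :=
  (ContinuousLinearMap.mul ℝ ℂ).coeFn_holder a b

lemma mulL2_ae (a : Linfty) (u : L2) : ∀ᵐ x : ℝ, mulL2 a u x = a x * u x :=
  (ContinuousLinearMap.mul ℝ ℂ).coeFn_holder a u

/-- The constant functions in `L^∞`. -/
def constInfty : ℂ →L[ℝ] Linfty :=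
  LinearMap.mkContinuous
    { toFun := fun c => (memLp_top_const c).toLp (fun _ => c)
      map_add' := fun _ _ => rfl
      map_smul' := fun _ _ => rfl } 1 fun c => by
    refine (Lp.norm_toLp _ (memLp_top_const c)).le.trans ?_
    refine ENNReal.toReal_le_of_le_ofReal (by positivity) ?_
    rw [eLpNorm_exponent_top, one_mul]
    exact eLpNormEssSup_le_of_ae_bound (Eventually.of_forall fun _ => le_rfl)

lemma constInfty_ae (c : ℂ) : ∀ᵐ x : ℝ, constInfty c x = c := (memLp_top_const c).coeFn_toLp

/-- Multiplication by `i` on `L²`. -/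
def mulI : L2 →L[ℝ] L2 := pointwise ((ContinuousLinearMap.mul ℝ ℂ) Complex.I)

/-- Complex conjugation on `L²`. -/
def conjL2 : L2 →L[ℝ] L2 := pointwise (Complex.conjCLE : ℂ →L[ℝ] ℂ)

lemma mulI_ae (u : L2) : ∀ᵐ x : ℝ, mulI u x = Complex.I * u x := pointwise_ae _ u

lemma conjL2_ae (u : L2) : ∀ᵐ x : ℝ, conjL2 u x = starRingEnd ℂ (u x) := pointwise_ae _ u

/-- The cubic map `(c, w) ↦ |w + c|² (w + c) - |c|² c` from `ℂ × H²` to `L²`, written as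
`(w + c)² w̄ + c̄ (w + 2 c) w`, with one factor in `L²` and the others in `L^∞`. -/
def cubic (c : ℂ) (w : H2Even) : L2 :=
  mulL2 (mulInfty (toLinfty w + constInfty c) (toLinfty w + constInfty c)) (conjL2 (toL2CLM w)) +
    mulL2 (mulInfty (constInfty (Complex.conjCLE c)) (toLinfty w + constInfty c + constInfty c))
      (toL2CLM w)

lemma cubic_ae (f : ℝ) (c : ℂ) (w : H2Even) :
    ∀ᵐ x : ℝ, cubic c w x = g f (toL2 w x + c) - g f c := by
  set a := toLinfty w + constInfty c with ha
  filter_upwards [Lp.coeFn_add (mulL2 (mulInfty a a) (conjL2 (toL2CLM w)))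
      (mulL2 (mulInfty (constInfty (Complex.conjCLE c)) (a + constInfty c)) (toL2CLM w)),
    mulL2_ae (mulInfty a a) (conjL2 (toL2CLM w)), mulInfty_ae a a, conjL2_ae (toL2CLM w),
    mulL2_ae (mulInfty (constInfty (Complex.conjCLE c)) (a + constInfty c)) (toL2CLM w),
    mulInfty_ae (constInfty (Complex.conjCLE c)) (a + constInfty c),
    constInfty_ae (Complex.conjCLE c), Lp.coeFn_add a (constInfty c), constInfty_ae c,
    Lp.coeFn_add (toLinfty w) (constInfty c), toLinfty_ae_eq w, toL2_ae_eq w]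
    with x h1 h2 h3 h4 h5 h6 h7 h8 h9 h10 h11 h12
  rw [cubic, h1, Pi.add_apply, h2, h3, h4, h5, h6, h7, h8, Pi.add_apply, h9, ha, h10, Pi.add_apply,
    h11, h9, toL2CLM_apply, ← h12, g, g, sq_norm_mul_eq, sq_norm_mul_eq, map_add,
    Complex.conjCLE_apply, Complex.conjCLE_apply]
  ring

/-- The left-hand side of the equation for `w`, as a function of the parameters `ε`, `κ`, of the
constant state `c`, and of `w`. Regarding `c` as an independent variable makes it a polynomial
map. -/
def perturbed (d ζ : ℝ) (x : (ℝ × ℝ × ℂ) × H2Even) : L2 :=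
  -d • weakDeriv2CLM x.2 + ζ • toL2CLM x.2 - x.1.1 • mulI (toL2CLM x.2)
    - (cubic x.1.2.2 x.2 + x.1.2.1 • mulI (cubic x.1.2.2 x.2))

lemma perturbed_ae (d ζ f ε κ : ℝ) (c : ℂ) (w : H2Even) :
    ∀ᵐ x : ℝ, perturbed d ζ ((ε, κ, c), w) x =
      -(d : ℂ) * weakDeriv2 w x + ζ * toL2 w x - ε * Complex.I * toL2 w x
        - (1 + Complex.I * κ) * (g f (toL2 w x + c) - g f c) := by
  filter_upwards [Lp.coeFn_sub (-d • weakDeriv2CLM w + ζ • toL2CLM w - ε • mulI (toL2CLM w))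
      (cubic c w + κ • mulI (cubic c w)),
    Lp.coeFn_sub (-d • weakDeriv2CLM w + ζ • toL2CLM w) (ε • mulI (toL2CLM w)),
    Lp.coeFn_add (-d • weakDeriv2CLM w) (ζ • toL2CLM w), Lp.coeFn_smul (-d) (weakDeriv2CLM w),
    Lp.coeFn_smul ζ (toL2CLM w), Lp.coeFn_smul ε (mulI (toL2CLM w)), mulI_ae (toL2CLM w),
    Lp.coeFn_add (cubic c w) (κ • mulI (cubic c w)), Lp.coeFn_smul κ (mulI (cubic c w)),
    mulI_ae (cubic c w), cubic_ae f c w] with x h1 h2 h3 h4 h5 h6 h7 h8 h9 h10 h11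
  rw [perturbed, h1, Pi.sub_apply, h2, Pi.sub_apply, h3, Pi.add_apply, h4, h5, h6, h8, Pi.add_apply,
    h9, Pi.smul_apply, Pi.smul_apply, Pi.smul_apply, Pi.smul_apply, h7, h10, h11]
  simp only [weakDeriv2CLM_apply, toL2CLM_apply, Complex.real_smul]
  push_cast
  ring

lemma reflect_perturbed (d ζ : ℝ) (p : ℝ × ℝ × ℂ) (w : H2Even) :
    reflect (perturbed d ζ (p, w)) = perturbed d ζ (p, w) := by
  obtain ⟨ε, κ, c⟩ := p
  rw [← isEven_iff]
  have h1 := (isEven_iff _).2 (reflect_toL2 w)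
  have h2 := (isEven_iff _).2 (reflect_weakDeriv2 w)
  filter_upwards [perturbed_ae d ζ 0 ε κ c w, ae_neg (perturbed_ae d ζ 0 ε κ c w), h1, h2]
    with x e1 e2 e3 e4
  rw [e1, e2, e3, e4]

lemma perturbed_eq_zero_iff (d ζ f ε κ : ℝ) (c : ℂ) (w : H2Even) :
    evenPart (perturbed d ζ ((ε, κ, c), w)) = 0 ↔ IsSolution d ζ f ε κ c w := by
  rw [← Submodule.coe_eq_zero, coe_evenPart_of_mem (reflect_perturbed d ζ _ w)]
  constructor
  · intro h
    filter_upwards [perturbed_ae d ζ f ε κ c w, Lp.coeFn_zero ℂ 2 (volume : Measure ℝ)]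
      with x h1 h2
    rw [← h1, h, h2, Pi.zero_apply]
  · intro h
    refine Lp.ext ?_
    filter_upwards [perturbed_ae d ζ f ε κ c w, Lp.coeFn_zero ℂ 2 (volume : Measure ℝ), h]
      with x h1 h2 h3
    rw [h1, h2, Pi.zero_apply, h3]

lemma contDiff_cubic : ContDiff ℝ 1 fun x : ℂ × H2Even => cubic x.1 x.2 := by
  have h0 : ContDiff ℝ 1 fun x : ℂ × H2Even => toL2CLM x.2 := toL2CLM.contDiff.comp contDiff_snd
  have h1 : ContDiff ℝ 1 fun x : ℂ × H2Even => conjL2 (toL2CLM x.2) := conjL2.contDiff.comp h0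
  have h2 : ContDiff ℝ 1 fun x : ℂ × H2Even => constInfty x.1 :=
    constInfty.contDiff.comp contDiff_fst
  have h3 : ContDiff ℝ 1 fun x : ℂ × H2Even => constInfty (Complex.conjCLE x.1) :=
    constInfty.contDiff.comp (Complex.conjCLE.contDiff.comp contDiff_fst)
  have h4 : ContDiff ℝ 1 fun x : ℂ × H2Even => toLinfty x.2 + constInfty x.1 :=
    (toLinfty.contDiff.comp contDiff_snd).add h2
  have h5 : ContDiff ℝ 1 fun x : ℂ × H2Even =>
      mulInfty (toLinfty x.2 + constInfty x.1) (toLinfty x.2 + constInfty x.1) :=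
    (mulInfty.contDiff.comp h4).clm_apply h4
  have h6 : ContDiff ℝ 1 fun x : ℂ × H2Even => mulInfty (constInfty (Complex.conjCLE x.1))
      (toLinfty x.2 + constInfty x.1 + constInfty x.1) :=
    (mulInfty.contDiff.comp h3).clm_apply (h4.add h2)
  exact ((mulL2.contDiff.comp h5).clm_apply h1).add ((mulL2.contDiff.comp h6).clm_apply h0)

lemma contDiff_perturbed (d ζ : ℝ) : ContDiff ℝ 1 (perturbed d ζ) := by
  have h0 : ContDiff ℝ 1 fun x : (ℝ × ℝ × ℂ) × H2Even => toL2CLM x.2 :=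
    toL2CLM.contDiff.comp contDiff_snd
  have h1 : ContDiff ℝ 1 fun x : (ℝ × ℝ × ℂ) × H2Even => weakDeriv2CLM x.2 :=
    weakDeriv2CLM.contDiff.comp contDiff_snd
  have h2 : ContDiff ℝ 1 fun x : (ℝ × ℝ × ℂ) × H2Even => cubic x.1.2.2 x.2 :=
    ContDiff.comp (g := fun x : ℂ × H2Even => cubic x.1 x.2)
      (f := fun x : (ℝ × ℝ × ℂ) × H2Even => (x.1.2.2, x.2)) contDiff_cubic ((contDiff_snd.comp (contDiff_snd.comp contDiff_fst)).prodMk contDiff_snd)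
  have h3 : ContDiff ℝ 1 fun x : (ℝ × ℝ × ℂ) × H2Even => x.1.1 := contDiff_fst.comp contDiff_fst
  have h4 : ContDiff ℝ 1 fun x : (ℝ × ℝ × ℂ) × H2Even => x.1.2.1 :=
    contDiff_fst.comp (contDiff_snd.comp contDiff_fst)
  have h5 : ContDiff ℝ 1 fun x : (ℝ × ℝ × ℂ) × H2Even => x.1.1 • mulI (toL2CLM x.2) :=
    h3.smul (mulI.contDiff.comp h0)
  have h6 : ContDiff ℝ 1 fun x : (ℝ × ℝ × ℂ) × H2Even => x.1.2.1 • mulI (cubic x.1.2.2 x.2) :=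
    h4.smul (mulI.contDiff.comp h2)
  have h7 : ContDiff ℝ 1 fun x : (ℝ × ℝ × ℂ) × H2Even => -d • weakDeriv2CLM x.2 :=
    h1.const_smul (-d)
  have h8 : ContDiff ℝ 1 fun x : (ℝ × ℝ × ℂ) × H2Even => ζ • toL2CLM x.2 := h0.const_smul ζ
  have e : perturbed d ζ = ((fun x : (ℝ × ℝ × ℂ) × H2Even => -d • weakDeriv2CLM x.2)
      + (fun x => ζ • toL2CLM x.2) - (fun x => x.1.1 • mulI (toL2CLM x.2)))
      - ((fun x => cubic x.1.2.2 x.2) + fun x => x.1.2.1 • mulI (cubic x.1.2.2 x.2)) := rfl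
  rw [e]
  exact ((h7.add h8).sub h5).sub (h2.add h6)

/-- The derivative of the cubic map at `w` in direction `h` is `2 |u|² h + u² h̄` with `u = w + c`. -/
lemma exists_hasDerivAt_cubic (c : ℂ) (w h : H2Even) :
    ∃ N : L2, HasDerivAt (fun t : ℝ => cubic c (w + t • h)) N 0 ∧
      ∀ᵐ x : ℝ, N x = 2 * (val w x + c) * starRingEnd ℂ (val w x + c) * val h x
        + (val w x + c) ^ 2 * starRingEnd ℂ (val h x) := by
  have hw : HasDerivAt (fun t : ℝ => w + t • h) h 0 := by
    simpa using ((hasDerivAt_id (0 : ℝ)).smul_const h).const_add w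
  have l0 : HasDerivAt (fun t : ℝ => toL2CLM (w + t • h)) (toL2CLM h) 0 :=
    toL2CLM.hasFDerivAt.comp_hasDerivAt 0 hw
  have l1 : HasDerivAt (fun t : ℝ => conjL2 (toL2CLM (w + t • h))) (conjL2 (toL2CLM h)) 0 :=
    conjL2.hasFDerivAt.comp_hasDerivAt 0 l0
  have l2 : HasDerivAt (fun t : ℝ => toLinfty (w + t • h) + constInfty c) (toLinfty h) 0 :=
    (toLinfty.hasFDerivAt.comp_hasDerivAt 0 hw).add_const _
  have l3 := (mulInfty.hasFDerivAt.comp_hasDerivAt 0 l2).clm_apply l2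
  have l4 := ((mulInfty (constInfty (Complex.conjCLE c))).hasFDerivAt.comp_hasDerivAt 0
    (l2.add_const (constInfty c)))
  have l5 := ((mulL2.hasFDerivAt.comp_hasDerivAt 0 l3).clm_apply l1).add
    ((mulL2.hasFDerivAt.comp_hasDerivAt 0 l4).clm_apply l0)
  refine ⟨_, l5, ?_⟩
  simp only [Function.comp_apply, zero_smul, add_zero]
  set a := toLinfty w + constInfty c with ha
  set b := toLinfty h with hb
  set k := constInfty (Complex.conjCLE c) with hk
  filter_upwards [Lp.coeFn_add
      (mulL2 (mulInfty b a + mulInfty a b) (conjL2 (toL2CLM w))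
        + mulL2 (mulInfty a a) (conjL2 (toL2CLM h)))
      (mulL2 (mulInfty k b) (toL2CLM w) + mulL2 (mulInfty k (a + constInfty c)) (toL2CLM h)),
    Lp.coeFn_add (mulL2 (mulInfty b a + mulInfty a b) (conjL2 (toL2CLM w)))
      (mulL2 (mulInfty a a) (conjL2 (toL2CLM h))),
    Lp.coeFn_add (mulL2 (mulInfty k b) (toL2CLM w))
      (mulL2 (mulInfty k (a + constInfty c)) (toL2CLM h)),
    mulL2_ae (mulInfty b a + mulInfty a b) (conjL2 (toL2CLM w)),
    mulL2_ae (mulInfty a a) (conjL2 (toL2CLM h)), mulL2_ae (mulInfty k b) (toL2CLM w),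
    mulL2_ae (mulInfty k (a + constInfty c)) (toL2CLM h),
    Lp.coeFn_add (mulInfty b a) (mulInfty a b), mulInfty_ae b a, mulInfty_ae a b, mulInfty_ae a a,
    mulInfty_ae k b, mulInfty_ae k (a + constInfty c), Lp.coeFn_add a (constInfty c),
    Lp.coeFn_add (toLinfty w) (constInfty c), constInfty_ae c, constInfty_ae (Complex.conjCLE c),
    toLinfty_ae_eq w, toLinfty_ae_eq h, conjL2_ae (toL2CLM w), conjL2_ae (toL2CLM h),
    toL2_ae_eq w, toL2_ae_eq h] with x h1 h2 h3 h4 h5 h6 h7 h8 h9 h10 h11 h12 h13 h14 h15 h16 h17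
      h18 h19 h20 h21 h22 h23
  rw [h1, Pi.add_apply, h2, h3, Pi.add_apply, Pi.add_apply, h4, h5, h6, h7, h8, Pi.add_apply, h9,
    h10, h11, h12, h13, h14, Pi.add_apply, ha, h15, Pi.add_apply, h16, hk, h17, h18, hb, h19, h20,
    h21, toL2CLM_apply, toL2CLM_apply, h22, h23, map_add, Complex.conjCLE_apply]
  ring

lemma exists_hasDerivAt_perturbed (d ζ : ℝ) (c : ℂ) (w h : H2Even) :
    ∃ N : L2, HasDerivAt (fun t : ℝ => perturbed d ζ ((0, 0, c), w + t • h)) N 0 ∧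
      ∀ᵐ x : ℝ, N x = -d * weakDeriv2 h x + ζ * val h x
        - (2 * (val w x + c) * starRingEnd ℂ (val w x + c) * val h x
        + (val w x + c) ^ 2 * starRingEnd ℂ (val h x)) := by
  obtain ⟨N, hN, hNx⟩ := exists_hasDerivAt_cubic c w h
  have hw : HasDerivAt (fun t : ℝ => w + t • h) h 0 := by
    simpa using ((hasDerivAt_id (0 : ℝ)).smul_const h).const_add w
  have l0 : HasDerivAt (fun t : ℝ => toL2CLM (w + t • h)) (toL2CLM h) 0 :=
    toL2CLM.hasFDerivAt.comp_hasDerivAt 0 hw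
  have l1 : HasDerivAt (fun t : ℝ => weakDeriv2CLM (w + t • h)) (weakDeriv2CLM h) 0 :=
    weakDeriv2CLM.hasFDerivAt.comp_hasDerivAt 0 hw
  have l2 := ((l1.const_smul (-d)).add (l0.const_smul ζ)).sub hN
  refine ⟨_, l2.congr_of_eventuallyEq (Eventually.of_forall fun t => ?_), ?_⟩
  · simp [perturbed]
  · filter_upwards [Lp.coeFn_sub (-d • weakDeriv2CLM h + ζ • toL2CLM h) N,
      Lp.coeFn_add (-d • weakDeriv2CLM h) (ζ • toL2CLM h), Lp.coeFn_smul (-d) (weakDeriv2CLM h),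
      Lp.coeFn_smul ζ (toL2CLM h), hNx, toL2_ae_eq h] with x h1 h2 h3 h4 h5 h6
    rw [h1, Pi.sub_apply, h2, Pi.add_apply, h3, h4, h5, Pi.smul_apply, Pi.smul_apply,
      weakDeriv2CLM_apply, toL2CLM_apply, h6, Complex.real_smul, Complex.real_smul]
    push_cast
    ring

/-- The linearization at a pulse `u = i (v + w)` acts diagonally on real and imaginary parts. -/
lemma linearized_eq_diag (ζ y : ℝ) (z : ℂ) :
    ζ * z - (2 * (Complex.I * y) * starRingEnd ℂ (Complex.I * y) * z
      + (Complex.I * y) ^ 2 * starRingEnd ℂ z) = diagCLM (ζ - y ^ 2) (ζ - 3 * y ^ 2) z := by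
  rw [diagCLM_apply]
  apply Complex.ext <;> simp [sq] <;> ring

/-- The linearization at a pulse is an isomorphism between even functions. -/
lemma bijective_linearized {d ζ v σ : ℝ} (hd : 0 < d) (ha : 0 < ζ - 3 * v ^ 2)
    (hf : -ζ * v + v ^ 3 ≠ 0) {w w' : ℝ → ℝ} (hw : IsPulse d ζ v σ w w')
    (heven : ∀ x, w (-x) = w x) {L : H2Even →L[ℝ] L2Even}
    (hL : ∀ h, ∀ᵐ x : ℝ, (L h : L2) x = -d * weakDeriv2 h x
      + diagCLM (ζ - (v + w x) ^ 2) (ζ - 3 * (v + w x) ^ 2) (val h x)) :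
    Function.Bijective L := by
  have hwc := hw.continuous
  obtain ⟨C, hC⟩ := hw.bounded
  -- the potential decays at infinity, and so gives a relatively compact perturbation
  have hq : MemLp (fun x => (2 * v + w x) * w x) 2 (volume : Measure ℝ) :=
    memLp_two_of_bounded_mul (C := |2 * v| + C) hw.memLp (by fun_prop) fun x =>
      (abs_add_le _ _).trans (add_le_add le_rfl (hC x))
  obtain ⟨K, hK, hKx⟩ := exists_compact_mul hq
  have hVx : ∀ h, ∀ᵐ x : ℝ, (pointwise (diagCLM (-1) (-3))).comp K h x
      = diagCLM (-1) (-3) (((2 * v + w x) * w x : ℝ) * val h x) := by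
    intro h
    filter_upwards [pointwise_ae (diagCLM (-1) (-3)) (K h), hKx h] with x h1 h2
    rw [ContinuousLinearMap.comp_apply, h1, h2]
  refine bijective_of_injective hd (m := ζ - v ^ 2) (n := ζ - 3 * v ^ 2)
    (by nlinarith [sq_nonneg v]) ha (V := (pointwise (diagCLM (-1) (-3))).comp K)
    (hK.clm_comp (pointwise (diagCLM (-1) (-3)))) (fun h => ?_) (fun h => ?_) fun h hh => ?_
  · rw [← isEven_iff]
    filter_upwards [hVx h, ae_neg (hVx h)] with x h1 h2
    rw [h1, h2, heven, val_neg_apply]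
  · refine Lp.ext ?_
    filter_upwards [hL h, hVx h,
      Lp.coeFn_add (-d • weakDeriv2 h + pointwise (diagCLM (ζ - v ^ 2) (ζ - 3 * v ^ 2)) (toL2 h))
        ((pointwise (diagCLM (-1) (-3))).comp K h),
      Lp.coeFn_add (-d • weakDeriv2 h) (pointwise (diagCLM (ζ - v ^ 2) (ζ - 3 * v ^ 2)) (toL2 h)),
      Lp.coeFn_smul (-d) (weakDeriv2 h),
      pointwise_ae (diagCLM (ζ - v ^ 2) (ζ - 3 * v ^ 2)) (toL2 h), toL2_ae_eq h]
      with x h1 h2 h3 h4 h5 h6 h7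
    rw [h1, h3, Pi.add_apply, h2, h4, Pi.add_apply, h5, Pi.smul_apply, h6, h7]
    simp only [diagCLM_apply]
    apply Complex.ext <;> simp <;> ring
  · have hcont := continuous_val h
    let k : ℝ → ℂ := fun x =>
      ⟨(ζ - (v + w x) ^ 2) / d * (val h x).re, (ζ - 3 * (v + w x) ^ 2) / d * (val h x).im⟩
    have hk : Continuous k := by
      have e : k = fun x => (((ζ - (v + w x) ^ 2) / d * (val h x).re : ℝ) : ℂ)
          + (((ζ - 3 * (v + w x) ^ 2) / d * (val h x).im : ℝ) : ℂ) * Complex.I := by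
        exact funext fun x => Complex.mk_eq_add_mul_I _ _
      rw [e]
      have hre : Continuous fun x => (val h x).re := Complex.continuous_re.comp hcont
      have him : Continuous fun x => (val h x).im := Complex.continuous_im.comp hcont
      fun_prop
    have h2k : ∀ᵐ x : ℝ, weakDeriv2 h x = k x := by
      have h0 : (L h : L2) = 0 := by rw [hh]; rfl
      filter_upwards [hL h, Lp.coeFn_zero ℂ 2 (volume : Measure ℝ)] with x h1 h2
      rw [h0, h2, Pi.zero_apply, diagCLM_apply] at h1
      have r1 := congrArg Complex.re h1
      have r2 := congrArg Complex.im h1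
      simp at r1 r2
      have hd0 := hd.ne'
      apply Complex.ext <;> simp only [k] <;> field_simp <;> linarith
    have hD : ∀ x, HasDerivAt (der h) (k x) x := hasDerivAt_der hk h2k
    have hz := der_zero h
    refine eq_zero_of_val_eq_zero fun x => Complex.ext ?_ ?_
    · exact hw.eq_zero_of_linearized_re hd hf (fun x => hasDerivAt_re (hasDerivAt_val h x))
        (fun x => hasDerivAt_re (hD x)) (by simp [hz]) (memLp_val h).re (memLp_der h).re x
    · exact hw.eq_zero_of_linearized_im (fun x => hasDerivAt_im (hasDerivAt_val h x))
        (fun x => hasDerivAt_im (hD x)) (by simp [hz]) (memLp_val h).im (memLp_der h).im x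

/-- Continuation of a pulse, with the constant state `c` as an independent parameter. -/
lemma exists_continuation {d ζ f v σ : ℝ} (hd : 0 < d) (hf : f ≠ 0) (hv : -ζ * v + v ^ 3 = f)
    (ha : 0 < ζ - 3 * v ^ 2) {w w' : ℝ → ℝ} (hw : IsPulse d ζ v σ w w')
    (heven : ∀ x, w (-x) = w x) {w₀ : H2Even} (hw₀ : ∀ᵐ x : ℝ, toL2 w₀ x = Complex.I * w x) :
    ∃ (J : Set (ℝ × ℝ × ℂ)) (U : Set H2Even), IsOpen J ∧ (0, 0, Complex.I * (v : ℂ)) ∈ J ∧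
      IsOpen U ∧ w₀ ∈ U ∧
      ∀ p ∈ J, ∃! w : H2Even, w ∈ U ∧ IsSolution d ζ f p.1 p.2.1 p.2.2 w := by
  have hwc := hw.continuous
  have hval : val w₀ = fun x => Complex.I * (w x : ℂ) :=
    val_eq_of_ae (continuous_const.mul (Complex.continuous_ofReal.comp hwc)) hw₀
  have hu : ∀ x, val w₀ x + Complex.I * (v : ℂ) = Complex.I * ((v + w x : ℝ) : ℂ) := fun x => by
    rw [hval]; push_cast; ring
  have hcd : ContDiff ℝ 1 fun x => evenPart (perturbed d ζ x) :=
    evenPart.contDiff.comp (contDiff_perturbed d ζ)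
  have hst := hcd.hasStrictFDerivAt (x := ((0, 0, Complex.I * (v : ℂ)), w₀)) (by norm_num)
  set F' := fderiv ℝ (fun x => evenPart (perturbed d ζ x)) ((0, 0, Complex.I * (v : ℂ)), w₀)
  have hL : ∀ h, ∀ᵐ x : ℝ, ((F' ∘L .inr ℝ (ℝ × ℝ × ℂ) H2Even) h : L2) x = -d * weakDeriv2 h x
      + diagCLM (ζ - (v + w x) ^ 2) (ζ - 3 * (v + w x) ^ 2) (val h x) := by
    intro h
    obtain ⟨N, hN, hNx⟩ := exists_hasDerivAt_perturbed d ζ (Complex.I * (v : ℂ)) w₀ h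
    have l1 : HasDerivAt (fun t : ℝ => (((0, 0, Complex.I * (v : ℂ)), w₀ + t • h) :
        (ℝ × ℝ × ℂ) × H2Even)) (0, h) 0 :=
      (hasDerivAt_const (0 : ℝ) ((0, 0, Complex.I * (v : ℂ)) : ℝ × ℝ × ℂ)).prodMk (by
        simpa using ((hasDerivAt_id (0 : ℝ)).smul_const h).const_add w₀)
    have l2 : HasDerivAt (fun t : ℝ =>
        evenPart (perturbed d ζ ((0, 0, Complex.I * (v : ℂ)), w₀ + t • h))) (F' (0, h)) 0 :=
      HasFDerivAt.comp_hasDerivAt_of_eq (0 : ℝ) hst.hasFDerivAt l1 (by simp)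
    have l3 : HasDerivAt (fun t : ℝ => ((evenPart
        (perturbed d ζ ((0, 0, Complex.I * (v : ℂ)), w₀ + t • h)) : L2Even) : L2))
        (F' (0, h) : L2) 0 := L2Even.subtypeL.hasFDerivAt.comp_hasDerivAt 0 l2
    simp only [coe_evenPart_of_mem (reflect_perturbed d ζ _ _)] at l3
    have e : ((F' ∘L .inr ℝ (ℝ × ℝ × ℂ) H2Even) h : L2) = N := l3.unique hN
    rw [e]
    filter_upwards [hNx] with x hx
    rw [hx, hu, add_sub_assoc, linearized_eq_diag]
  have hsol : IsSolution d ζ f 0 0 (Complex.I * v) w₀ := by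
    have hk : ∀ᵐ x : ℝ, weakDeriv2 w₀ x = Complex.I *
        ((((ζ - 3 * v ^ 2) * w x - 3 * v * w x ^ 2 - w x ^ 3) / d : ℝ) : ℂ) := by
      have hder : der w₀ = fun x => Complex.I * (w' x : ℂ) := by
        funext x
        have h1 := hasDerivAt_val w₀ x
        rw [hval] at h1
        exact h1.unique (((hw.hasDerivAt x).ofReal_comp).const_mul Complex.I)
      have m2 : MemLp (fun x => Complex.I *
          ((((ζ - 3 * v ^ 2) * w x - 3 * v * w x ^ 2 - w x ^ 3) / d : ℝ) : ℂ)) 2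
          (volume : Measure ℝ) := hw.memLp_deriv2.ofReal.const_mul Complex.I
      have d1 : IsWeakDeriv (weakDeriv1 w₀) (m2.toLp _) := by
        refine isWeakDeriv_of_hasDerivAt (U := fun x => Complex.I * (w' x : ℂ)) ?_ m2.coeFn_toLp
          fun x => ((hw.hasDerivAt' x).ofReal_comp).const_mul Complex.I
        filter_upwards [weakDeriv1_ae_eq w₀] with x hx
        rw [hx, hder]
      rw [show weakDeriv2 w₀ = m2.toLp _ from IsWeakDeriv.unique w₀.2.2.1 d1]
      exact m2.coeFn_toLp
    filter_upwards [hk, toL2_ae_eq w₀] with x h1 h2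
    have n1 : ∀ t : ℝ, (‖Complex.I * (t : ℂ)‖ : ℂ) ^ 2 = (t : ℂ) ^ 2 := fun t => by
      rw [norm_mul, Complex.norm_I, one_mul, Complex.norm_real, ← Complex.ofReal_pow,
        Real.norm_eq_abs, sq_abs, Complex.ofReal_pow]
    have hd0 : (d : ℂ) ≠ 0 := Complex.ofReal_ne_zero.2 hd.ne'
    rw [h1, h2, hu, hval, g, g, n1, n1]
    push_cast
    field_simp
    ring
  obtain ⟨J, U, φ, hJ, h0J, hU, h0U, -, H⟩ := exists_unique_continuation hst
    ((perturbed_eq_zero_iff d ζ f 0 0 (Complex.I * v) w₀).2 hsol)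
    (bijective_linearized hd ha (hv ▸ hf) hw heven hL)
  refine ⟨J, U, hJ, h0J, hU, h0U, fun p hp => ⟨φ p, ?_, fun w hw => ?_⟩⟩
  · have := (H p hp (φ p)).2 rfl
    exact ⟨this.1, (perturbed_eq_zero_iff d ζ f p.1 p.2.1 p.2.2 _).1 this.2⟩
  · exact (H p hp w).1 ⟨hw.1, (perturbed_eq_zero_iff d ζ f p.1 p.2.1 p.2.2 _).2 hw.2⟩

end LugiatoLefever

end

theorem theorem5 (d ζ f : ℝ) (hd : 0 < d) (hζ : 0 < ζ) (hf : 0 < |f|)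
    (hf' : |f| < 2 * √3 / 9 * ζ ^ (3 / 2 : ℝ)) :
    -- the three roots of `-ζ v + v³ = f`
    ∃ v₁ v₂ v₃ : ℝ, v₁ < v₂ ∧ v₂ < v₃ ∧
      (∀ v : ℝ, -ζ * v + v ^ 3 = f ↔ v = v₁ ∨ v = v₂ ∨ v = v₃) ∧
      -- the continuation `c` of the constant state `i v₂`
      ∃ (J₀ : Set (ℝ × ℝ)) (W : Set ℂ) (c : ℝ × ℝ → ℂ),
        IsOpen J₀ ∧ (0, 0) ∈ J₀ ∧ IsOpen W ∧ ContinuousOn c J₀ ∧ c (0, 0) = Complex.I * v₂ ∧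
        (∀ p ∈ J₀, ∀ z : ℂ,
          (z ∈ W ∧ LugiatoLefever.IsConstantState ζ f p.1 p.2 z) ↔ z = c p) ∧
        -- the two homoclinics (`σ = 1` and `σ = -1`) and their continuation
        ∀ σ : ℝ, σ = 1 ∨ σ = -1 →
          ∃ u : ℝ → ℂ, (∀ y : ℝ → ℂ, LugiatoLefever.IsHomoclinic d ζ f v₂ σ y ↔ y = u) ∧
            ∃ w₀ : LugiatoLefever.H2Even, (∀ᵐ x : ℝ, LugiatoLefever.toL2 w₀ x = u x - Complex.I * v₂) ∧
              ∃ (U : Set LugiatoLefever.H2Even) (J : Set (ℝ × ℝ)),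
                IsOpen U ∧ w₀ ∈ U ∧ IsOpen J ∧ (0, 0) ∈ J ∧ J ⊆ J₀ ∧
                ∀ p ∈ J, ∃! w : LugiatoLefever.H2Even,
                  w ∈ U ∧ LugiatoLefever.IsSolution d ζ f p.1 p.2 (c p) w := by
  obtain ⟨v₁, v₂, v₃, h12, h23, hroots, ha⟩ := LugiatoLefever.exists_roots hζ hf'
  have hv : -ζ * v₂ + v₂ ^ 3 = f := (hroots v₂).2 (Or.inr (Or.inl rfl))
  obtain ⟨J₀, W, c, hJ₀, h0, hW, hc, hc0, hcW⟩ := LugiatoLefever.exists_constantState hv ha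
  refine ⟨v₁, v₂, v₃, h12, h23, hroots, J₀, W, c, hJ₀, h0, hW, hc, hc0, hcW, fun σ hσ => ?_⟩
  obtain ⟨w, w', hw, heven, -, -⟩ := LugiatoLefever.exists_isPulse (d := d) (σ := σ) hd ha hσ
  obtain ⟨w₀, hw₀⟩ := hw.exists_H2Even heven
  refine ⟨fun x => Complex.I * (v₂ + w x : ℝ), fun y => ⟨fun hy => hy.unique hd hv ha hσ hw,
    fun hy => by rw [hy]; exact hw.isHomoclinic hd hv heven⟩, w₀, ?_, ?_⟩
  · filter_upwards [hw₀] with x hx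
    rw [hx]; push_cast; ring
  obtain ⟨J, U, hJ, hJ0, hU, hU0, H⟩ := LugiatoLefever.exists_continuation hd (abs_pos.1 hf) hv ha
    hw heven hw₀
  have hcont : ContinuousOn (fun p : ℝ × ℝ => (p.1, p.2, c p)) J₀ :=
    continuousOn_fst.prodMk (continuousOn_snd.prodMk hc)
  refine ⟨U, J₀ ∩ (fun p : ℝ × ℝ => (p.1, p.2, c p)) ⁻¹' J, hU, hU0,
    hcont.isOpen_inter_preimage hJ₀ hJ, ⟨h0, ?_⟩, Set.inter_subset_left, fun p hp => ?_⟩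
  · rw [Set.mem_preimage, hc0]
    exact hJ0
  · exact H (p.1, p.2, c p) hp.2
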